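/- Let $n\ge 1$ and let $B(n)$ be the set of subsets of $[n]=\{1,\dots,n\}$. Let $V(B(n))$ be the complex vector space with basis $B(n)$, carrying the permutation representation of $S_n$, let $V(B(n)_r)$ be the span of the subsets of size $r$, and let $U_n$ be the up operator, $U_n(X)=\sum_Y Y$ over all $Y\supseteq X$ with $|Y|=|X|+1$. A symmetric Jordan chain starting at rank $k$ and ending at rank $n-k$ is a sequence $(v_1,\dots,v_h)$, $h\ge1$, of nonzero homogeneous vectors with $U_n(v_{i-1})=v_i$ for $2\le i\le h$, $U_n(v_h)=0$, $v_1\in V(B(n)_k)$ and $v_h\in V(B(n)_{n-k})$. For $0\le k\le n/2$ let $\mathrm{tab}(n,(n-k,k))$ be the set of standard Young tableaux of shape $(n-k,k)$; for such a tableau $T$ and $j\in[n]$ let $b_T(j)$ be the box containing $j$, and let the content $c(b)$ of a box be its column index minus its row index. For $T\in\mathrm{tab}(n,(n-k,k))$ define a sequence $B_{n,k}(T)=(x_k,\dots,x_{n-k})$ in $V(B(n))$ recursively, as follows. For $n=1$ it is $(\emptyset,\{1\})$. Regard $V(B(n))$ as a subspace of $V(B(n+1))$, and let $v\mapsto\overline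 v$ be the linear map $V(B(n))\to V(B(n+1))$ with $X\mapsto X\cup\{n+1\}$. Let $B_{n,k}(T)=(x_k,\dots,x_{n-k})$ and put $x_{k-1}=x_{n+1-k}=0$. If $T'$ arises from $T$ by adding $n+1$ at the end of the first row, then $B_{n+1,k}(T')=(y_k,\dots,y_{n+1-k})$ with $y_l=x_l+(l-k)\,\overline{x_{l-1}}$, except that $B_{n+1,k}(T')=(x_k,\overline{x_k})$ if $k=n-k$. If $k<n-k$ and $T'$ arises from $T$ by adding $n+1$ at the end of the second row, then $B_{n+1,k+1}(T')=(z_{k+1},\dots,z_{n-k})$ with $z_l=(n-k-l+1)\,\overline{x_{l-1}}-x_l$. For $1\le j\le n$ let $Y_j=\sum_{i=1}^{j-1}(i,j)\in\mathbb C[S_n]$ be the Young–Jucys–Murphy elements of $S_n$. For $0\le k\le i\le n-k$ let $W(n,k,i)$ be the span of the rank $i$ members of the chains $B_{n,k}(T)$, $T\in\mathrm{tab}(n,(n-k,k))$. A Gelfand–Tsetlin subspace of an irreducible $S_n$-submodule $W$ of $V(B(n))$ is a subspace $F_1$ for which there is a chain $F_1\subseteq F_2\subseteq\cdots\subseteq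 F_n=W$ such that each $F_m$ is an irreducible $S_m$-submodule, where $S_m\subseteq S_n$ is the subgroup fixing $m+1,\dots,n$; a Gelfand–Tsetlin basis of $W$ is a basis of $W$ obtained by choosing a spanning vector in each Gelfand–Tsetlin subspace. Then, for all $0\le k\le n/2$ and $T\in\mathrm{tab}(n,(n-k,k))$, the sequence $B_{n,k}(T)$ is a symmetric Jordan chain starting at rank $k$ and ending at rank $n-k$, and every vector $v$ in it satisfies $$Y_j(v)=c(b_T(j))\,v,\qquad j=1,\dots,n.$$ Moreover, these chains give a Gelfand–Tsetlin basis of $V(B(n))$: the vectors of all the chains together form a basis of $V(B(n))$; $V(B(n))=\bigoplus_{0\le k\le i\le n-k}W(n,k,i)$; each $W(n,k,i)$ is an irreducible $S_n$-submodule; and the rank $i$ members of the chains $B_{n,k}(T)$, $T\in\mathrm{tab}(n,(n-k,k))$, form a Gelfand–Tsetlin basis of $W(n,k,i)$. -/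

import Mathlib

namespace Johnson

/-- `V(B(n))`: the complex vector space with basis the set `B(n)` of all subsets of
`{1, …, n}`. The element `j` of `{1, …, n}` is the element `j - 1` of `Fin n`. -/
abbrev V (n : ℕ) : Type := Finset (Fin n) →₀ ℂ

/-- The permutation representation of `S_n` on `V(B(n))`. -/
noncomputable def permRep (n : ℕ) : Representation ℂ (Equiv.Perm (Fin n)) (V n) where
  toFun π := Finsupp.lmapDomain ℂ ℂ (fun X : Finset (Fin n) => X.map π.toEmbedding)
  map_one' := by
    ext X : 1
    ext Y
    have h : X.map (1 : Equiv.Perm (Fin n)).toEmbedding = X := Finset.map_refl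
    simp [h]
  map_mul' π τ := by
    ext X : 1
    ext Y
    have h : X.map (π * τ).toEmbedding = (X.map τ.toEmbedding).map π.toEmbedding := by
      rw [Finset.map_map]; rfl
    simp [h]

/-- `V(B(n)_r)`, the span of the subsets of cardinality `r`. -/
noncomputable def level (n r : ℕ) : Submodule ℂ (V n) :=
  Finsupp.supported ℂ ℂ {X : Finset (Fin n) | X.card = r}

/-- The up operator: `X ↦ ∑ Y`, over all `Y` covering `X`. -/
noncomputable def up (n : ℕ) : V n →ₗ[ℂ] V n :=
  Finsupp.linearCombination ℂ fun X : Finset (Fin n) =>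
    ∑ Y : Finset (Fin n) with X ⊆ Y ∧ Y.card = X.card + 1, Finsupp.single Y (1 : ℂ)

/-- A symmetric Jordan chain `(v_1, …, v_h)` in `V(B(n))`, starting at rank `k`
and ending at rank `n - k`. -/
structure IsSymmetricJordanChain (n k : ℕ) (v : List (V n)) : Prop where
  ne_nil : v ≠ []
  ne_zero : ∀ x ∈ v, x ≠ 0
  homogeneous : ∀ x ∈ v, ∃ r, x ∈ level n r
  step : v.IsChain (fun x y => up n x = y)
  last : up n (v.getLast ne_nil) = 0
  start_rank : v.head ne_nil ∈ level n k
  end_rank : ∃ q, k + q = n ∧ v.getLast ne_nil ∈ level n q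

/-- The Young–Jucys–Murphy element `Y_j = ∑_{i < j} (i, j)` of the group algebra `ℂ[S_n]`. -/
noncomputable def yjm (n : ℕ) (j : Fin n) : MonoidAlgebra ℂ (Equiv.Perm (Fin n)) :=
  ∑ i : Fin n with i < j, MonoidAlgebra.of ℂ (Equiv.Perm (Fin n)) (Equiv.swap i j)

/-- A standard Young tableau with `n` boxes and shape `μ`, given by the box `b_T(j)` in which
each `j` resides. A box `(a, b)` lies in row `a` and column `b`, both counted from `0`.
Entries increase along rows and down columns. -/
structure StandardYoungTableau (n : ℕ) (μ : YoungDiagram) where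
  box : Fin n ≃ {b : ℕ × ℕ // b ∈ μ.cells}
  row_increasing : ∀ i j : Fin n, (box i).1.1 = (box j).1.1 → (box i).1.2 < (box j).1.2 → i < j
  col_increasing : ∀ i j : Fin n, (box i).1.2 = (box j).1.2 → (box i).1.1 < (box j).1.1 → i < j

/-- The row in which `j` resides: `0` for the first row, `1` for the second. -/
def StandardYoungTableau.row {n : ℕ} {μ : YoungDiagram} (T : StandardYoungTableau n μ)
    (j : Fin n) : ℕ := (T.box j).1.1

/-- The content of a box: column index minus row index. -/
def content (b : ℕ × ℕ) : ℤ := (b.2 : ℤ) - (b.1 : ℤ)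

/-- The Young diagram of the partition `(n - k, k)`, where `0 ≤ k ≤ n / 2`. -/
def twoRow (n k : ℕ) (hk : 2 * k ≤ n) : YoungDiagram :=
  YoungDiagram.ofRowLens [n - k, k] (by
    rw [List.sortedGE_iff_pairwise]
    simp
    omega)

/-- `tab(n, (n - k, k))`. -/
abbrev Tab (n k : ℕ) (hk : 2 * k ≤ n) : Type := StandardYoungTableau n (twoRow n k hk)

/-- The inclusion `V(B(n)) → V(B(n + 1))`, sending `X ⊆ [n]` to `X`. -/
noncomputable def incl (n : ℕ) : V n →ₗ[ℂ] V (n + 1) :=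
  Finsupp.lmapDomain ℂ ℂ fun X : Finset (Fin n) => X.map Fin.castSuccEmb

/-- The linear map `v ↦ \bar v` from `V(B(n))` to `V(B(n + 1))`, sending `X ⊆ [n]` to
`X ∪ {n + 1}`. -/
noncomputable def bar (n : ℕ) : V n →ₗ[ℂ] V (n + 1) :=
  Finsupp.lmapDomain ℂ ℂ fun X : Finset (Fin n) => insert (Fin.last n) (X.map Fin.castSuccEmb)

/-- The recursive construction of the chains. A tableau with at most two rows arises from the
empty one by adding `1, 2, …` successively, each at the end of the first or of the second row;
`r j` is the row (`0` or `1`) to which `j` is added. The value at `l` is the member of rank `l`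
of the chain, and `0` when the chain has no member of that rank.

If `(x_k, …, x_{n-k})` is the chain of a tableau with `n` boxes, `k` of them in the second row,
then adding `n + 1` to the first row gives the chain
`y_l = x_l + (l - k) \bar x_{l-1}`, `k ≤ l ≤ n + 1 - k`, where `x_{k-1} = x_{n+1-k} = 0`
(which is `(x_k, \bar x_k)` if `k = n - k`), and adding `n + 1` to the second row gives
`z_l = (n - k - l + 1) \bar x_{l-1} - x_l`, `k + 1 ≤ l ≤ n - k`.
The chain of the empty tableau is `(∅)`, so that of the tableau with one box is `(∅, {1})`. -/
noncomputable def chainVec : (n : ℕ) → (Fin n → ℕ) → ℕ → V n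
  | 0, _, l => if l = 0 then Finsupp.single ∅ 1 else 0
  | n + 1, r, l =>
    let r' : Fin n → ℕ := fun j => r j.castSucc
    let k : ℕ := (Finset.univ.filter fun j => r' j = 1).card
    let x : ℕ → V n := chainVec n r'
    if r (Fin.last n) = 0 then
      if k ≤ l ∧ l ≤ n + 1 - k then
        incl n (x l) + ((l : ℂ) - (k : ℂ)) • bar n (x (l - 1))
      else 0
    else
      if k + 1 ≤ l ∧ l ≤ n - k then
        ((n : ℂ) - (k : ℂ) - (l : ℂ) + 1) • bar n (x (l - 1)) - incl n (x l)
      else 0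

/-- The member of rank `l` of the chain `B_{n,k}(T)`, where `k ≤ l ≤ n - k`. -/
noncomputable def jordanVec {n k : ℕ} {hk : 2 * k ≤ n} (T : Tab n k hk) (l : ℕ) : V n :=
  chainVec n T.row l

/-- The chain `B_{n,k}(T)`, as the sequence of its members of ranks `k, k + 1, …, n - k`. -/
noncomputable def jordanChain {n k : ℕ} {hk : 2 * k ≤ n} (T : Tab n k hk) : List (V n) :=
  (List.range' k (n + 1 - 2 * k)).map (jordanVec T)

/-- `S_m` as the subgroup of `S_n` that fixes `m + 1, …, n`. -/
def symSubgroup (n m : ℕ) : Subgroup (Equiv.Perm (Fin n)) :=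
  fixingSubgroup (Equiv.Perm (Fin n)) {j : Fin n | m ≤ (j : ℕ)}

/-- `W` is an irreducible `S_m`-submodule of `V(B(n))`. -/
def IsIrreducibleSubmodule (n m : ℕ) (W : Submodule ℂ (V n)) : Prop :=
  ∃ h : ∀ g : symSubgroup n m, W ≤ W.comap (((permRep n).comp (symSubgroup n m).subtype) g),
    Representation.IsIrreducible (k := ℂ) (G := symSubgroup n m) (V := W)
      (Representation.subrepresentation ((permRep n).comp (symSubgroup n m).subtype) W h)

/-- `L` is a Gelfand–Tsetlin subspace of the irreducible `S_n`-submodule `W` of `V(B(n))`, with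
respect to `S_1 ⊆ S_2 ⊆ ⋯ ⊆ S_n`: there is a chain `L = F_1 ⊆ F_2 ⊆ ⋯ ⊆ F_n = W` in which `F_m`
is an irreducible `S_m`-submodule. -/
def IsGZSubspace (n : ℕ) (W L : Submodule ℂ (V n)) : Prop :=
  ∃ F : ℕ → Submodule ℂ (V n), F n = W ∧ F 1 = L ∧
    (∀ m, 1 ≤ m → m < n → F m ≤ F (m + 1)) ∧
    (∀ m, 1 ≤ m → m ≤ n → IsIrreducibleSubmodule n m (F m))

/-- `b` is a Gelfand–Tsetlin basis of the irreducible `S_n`-submodule `W` of `V(B(n))`: a basis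
of `W` that consists of one vector from each Gelfand–Tsetlin subspace (these are lines, because
`S_1` is trivial). -/
structure IsGelfandTsetlinBasis {ι : Type} (n : ℕ) (W : Submodule ℂ (V n)) (b : ι → V n) :
    Prop where
  irreducible : IsIrreducibleSubmodule n n W
  linearIndependent : LinearIndependent ℂ b
  span_eq : Submodule.span ℂ (Set.range b) = W
  gz : ∀ L : Submodule ℂ (V n), IsGZSubspace n W L ↔ ∃ t, L = Submodule.span ℂ {b t}

/-- The pairs `(k, i)` with `0 ≤ k ≤ i ≤ n - k ≤ n`, where `k ≤ n / 2`. -/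
abbrev PairIndex (n : ℕ) : Type :=
  Σ k : {k : ℕ // 2 * k ≤ n}, {i : ℕ // k.1 ≤ i ∧ i ≤ n - k.1}

/-- `W(n, k, i)`: the span of the members of rank `i` of the chains `B_{n,k}(T)`. -/
noncomputable def W (n : ℕ) (p : PairIndex n) : Submodule ℂ (V n) :=
  Submodule.span ℂ (Set.range fun T : Tab n p.1.1 p.1.2 => jordanVec T p.2.1)

end Johnson

namespace Johnson

open Finset

/-! A two-row tableau is encoded by its row word, a ballot word in `0` and `1`; `ones r n` is the
length `k` of the second row. Splitting V(B(n+1)) into sets without and with n+1 (`incl` and `bar`),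
the operators `up`, `down` and Y_{n+1} become 2×2 block matrices in `up`, `down` and `grade` of
V(B(n)), while Y_j with j ≤ n acts blockwise. Induction on n then gives the chain relations: `up`
raises x_l to x_{l+1}, `down` takes x_{l+1} to (l+1-k)(n-k-l) x_l (`up_chainVec`, `down_chainVec`),
and these two make the recursion produce eigenvectors of Y_{n+1} (`yjmEnd_chainVec`).

The chains form a basis without any dimension count. They span (`chainVec_span`) since the two
extensions of a chain satisfy y_{l+1} + z_{l+1} = (n+1-2k) bar x_l, so both blocks are recovered.
They are independent because rank and contents are joint eigenvalues that determine the word and the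
rank.

The representation theory follows Okounkov and Vershik. For s = (j, j+1), the relation s Y_{j+1} =
Y_j s + 1 turns a joint eigenvector v with contents c into s v - (c_{j+1} - c_j)⁻¹ v, which is zero
or has the contents at j and j+1 exchanged. By the basis property it is a combination of chain
vectors with these contents. Hence the rank l vectors of one shape whose words agree from position m
on span an S_m-submodule (`classSpan_invariant`). Conversely, if the word reads 10 at j, j+1, the
contents differ by at least 2, so s² = 1 forces the swapped vector to occur with nonzero coefficient
(`chainVec_mem_iff_swap`); sorting connects all words of the class. A nonzero submodule contains a
joint eigenvector, hence a chain vector, hence the whole class: this is irreducibility. Y_1, …, Y_m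
still separate the words of a class for m+1, so the irreducible S_m-submodules of its span are
exactly the class spans for m; descending to m = 1 leaves the lines of the chain vectors. -/

/-! ### Operators on V(B(n)) and their block form on V(B(n+1)) -/

/-- The down operator: `X ↦ ∑ Y`, over all `Y` covered by `X`. -/
noncomputable def down (n : ℕ) : V n →ₗ[ℂ] V n :=
  Finsupp.linearCombination ℂ fun X : Finset (Fin n) =>
    ∑ x ∈ X, Finsupp.single (X.erase x) (1 : ℂ)

/-- The operator that multiplies each set by its cardinality. -/
noncomputable def grade (n : ℕ) : V n →ₗ[ℂ] V n :=
  Finsupp.linearCombination ℂ fun X : Finset (Fin n) => Finsupp.single X (X.card : ℂ)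

/-- The action of the Young–Jucys–Murphy element `Y_j` on `V(B(n))`. -/
noncomputable def yjmEnd (n : ℕ) (j : Fin n) : V n →ₗ[ℂ] V n :=
  ∑ i : Fin n with i < j, permRep n (Equiv.swap i j)

theorem asAlgebraHom_yjm (n : ℕ) (j : Fin n) :
    (permRep n).asAlgebraHom (yjm n j) = yjmEnd n j := by
  simp [yjm, yjmEnd, map_sum]

theorem down_single (n : ℕ) (X : Finset (Fin n)) :
    down n (Finsupp.single X 1) = ∑ x ∈ X, Finsupp.single (X.erase x) (1 : ℂ) := by
  simp [down]

theorem grade_single (n : ℕ) (X : Finset (Fin n)) :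
    grade n (Finsupp.single X 1) = (X.card : ℂ) • Finsupp.single X (1 : ℂ) := by
  simp [grade]

theorem up_single (n : ℕ) (X : Finset (Fin n)) :
    up n (Finsupp.single X 1) = ∑ x ∈ Xᶜ, Finsupp.single (insert x X) (1 : ℂ) := by
  simp only [up, Finsupp.linearCombination_single, one_smul]
  have h : (univ.filter fun Y : Finset (Fin n) => X ⊆ Y ∧ Y.card = X.card + 1) =
      Xᶜ.image fun x => insert x X := by
    ext Y
    simp only [mem_filter, mem_univ, true_and, mem_image, mem_compl]
    constructor
    · rintro ⟨h1, h2⟩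
      have h3 : (Y \ X).card = 1 := by
        rw [card_sdiff_of_subset h1]; omega
      obtain ⟨x, hx⟩ := card_eq_one.1 h3
      have hx' : x ∈ Y \ X := by rw [hx]; simp
      refine ⟨x, (mem_sdiff.1 hx').2, ?_⟩
      rw [← Finset.union_sdiff_of_subset h1, hx, insert_eq, union_comm]
    · rintro ⟨x, hx, rfl⟩
      exact ⟨subset_insert _ _, card_insert_of_notMem hx⟩
  rw [h, sum_image]
  intro x hx y hy hxy
  have hxy : insert x X = insert y X := hxy
  have : x ∈ insert y X := hxy ▸ mem_insert_self x X
  rcases mem_insert.1 this with h | h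
  · exact h
  · exact absurd h (by simpa using hx)

theorem permRep_single (n : ℕ) (π : Equiv.Perm (Fin n)) (X : Finset (Fin n)) :
    permRep n π (Finsupp.single X 1) = Finsupp.single (X.map π.toEmbedding) 1 := by
  simp [permRep]

theorem incl_single (n : ℕ) (X : Finset (Fin n)) :
    incl n (Finsupp.single X 1) = Finsupp.single (X.map Fin.castSuccEmb) 1 := by
  simp [incl]

theorem bar_single (n : ℕ) (X : Finset (Fin n)) :
    bar n (Finsupp.single X 1) =
      Finsupp.single (insert (Fin.last n) (X.map Fin.castSuccEmb)) 1 := by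
  simp [bar]

theorem last_notMem (n : ℕ) (X : Finset (Fin n)) : Fin.last n ∉ X.map Fin.castSuccEmb := by
  simp [Fin.castSucc_ne_last]

theorem linearMap_ext {n : ℕ} {M : Type*} [AddCommMonoid M] [Module ℂ M] {f g : V n →ₗ[ℂ] M}
    (h : ∀ X, f (Finsupp.single X 1) = g (Finsupp.single X 1)) (v : V n) : f v = g v := by
  have : f = g := Finsupp.lhom_ext' fun X => LinearMap.ext_ring (h X)
  rw [this]

theorem compl_map_castSucc (n : ℕ) (X : Finset (Fin n)) :
    (X.map Fin.castSuccEmb)ᶜ = insert (Fin.last n) (Xᶜ.map Fin.castSuccEmb) := by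
  ext x
  refine Fin.lastCases ?_ (fun i => ?_) x
  · simp [Fin.castSucc_ne_last]
  · simp [Fin.castSucc_ne_last]

theorem compl_insert_map_castSucc (n : ℕ) (X : Finset (Fin n)) :
    (insert (Fin.last n) (X.map Fin.castSuccEmb))ᶜ = Xᶜ.map Fin.castSuccEmb := by
  ext x
  refine Fin.lastCases ?_ (fun i => ?_) x
  · simp [Fin.castSucc_ne_last]
  · simp [Fin.castSucc_ne_last]

theorem up_incl (n : ℕ) (v : V n) : up (n + 1) (incl n v) = incl n (up n v) + bar n v := by
  refine linearMap_ext (f := up (n + 1) ∘ₗ incl n) (g := incl n ∘ₗ up n + bar n) (fun X => ?_) v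
  simp only [LinearMap.comp_apply, LinearMap.add_apply, incl_single, up_single, map_sum,
    bar_single, compl_map_castSucc]
  rw [sum_insert (last_notMem n _), sum_map]
  refine (add_comm _ _).trans ?_
  simp [map_insert]

theorem up_bar (n : ℕ) (v : V n) : up (n + 1) (bar n v) = bar n (up n v) := by
  refine linearMap_ext (f := up (n + 1) ∘ₗ bar n) (g := bar n ∘ₗ up n) (fun X => ?_) v
  simp only [LinearMap.comp_apply, up_single, map_sum,
    bar_single, compl_insert_map_castSucc, sum_map]
  refine sum_congr rfl fun x _ => ?_
  rw [map_insert, insert_comm]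

theorem map_erase_castSucc (n : ℕ) (X : Finset (Fin n)) (x : Fin n) :
    (X.erase x).map Fin.castSuccEmb = (X.map Fin.castSuccEmb).erase x.castSucc :=
  map_erase _ _ _

theorem down_incl (n : ℕ) (v : V n) : down (n + 1) (incl n v) = incl n (down n v) := by
  refine linearMap_ext (f := down (n + 1) ∘ₗ incl n) (g := incl n ∘ₗ down n) (fun X => ?_) v
  simp only [LinearMap.comp_apply, down_single, map_sum, incl_single, sum_map,
    map_erase_castSucc]
  rfl

theorem down_bar (n : ℕ) (v : V n) :
    down (n + 1) (bar n v) = bar n (down n v) + incl n v := by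
  refine linearMap_ext (f := down (n + 1) ∘ₗ bar n) (g := bar n ∘ₗ down n + incl n)
    (fun X => ?_) v
  simp only [LinearMap.comp_apply, LinearMap.add_apply, down_single, map_sum, incl_single,
    bar_single, map_erase_castSucc]
  rw [sum_insert (last_notMem n _), sum_map, erase_insert (last_notMem n _)]
  refine (add_comm _ _).trans ?_
  congr 1
  refine sum_congr rfl fun x _ => ?_
  rw [erase_insert_of_ne]
  · rfl
  · exact (Fin.castSucc_ne_last x).symm

theorem map_swap_castSucc (n : ℕ) (i j : Fin n) (X : Finset (Fin n)) :
    (X.map Fin.castSuccEmb).map (Equiv.swap i.castSucc j.castSucc).toEmbedding =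
      (X.map (Equiv.swap i j).toEmbedding).map Fin.castSuccEmb := by
  rw [map_map, map_map]
  congr 1
  ext x
  simp only [Function.Embedding.trans_apply, Equiv.coe_toEmbedding, Fin.castSuccEmb_apply]
  rw [← (Fin.castSucc_injective n).map_swap]

theorem sum_lt_castSucc {M : Type*} [AddCommMonoid M] (n : ℕ) (j : Fin n) (f : Fin (n + 1) → M) :
    ∑ i : Fin (n + 1) with i < j.castSucc, f i = ∑ i : Fin n with i < j, f i.castSucc := by
  rw [sum_filter, Fin.sum_univ_castSucc, sum_filter]
  have h : ¬ Fin.last n < j.castSucc := not_lt.2 (Fin.le_last _)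
  simp [h]

theorem sum_lt_last {M : Type*} [AddCommMonoid M] (n : ℕ) (f : Fin (n + 1) → M) :
    ∑ i : Fin (n + 1) with i < Fin.last n, f i = ∑ i : Fin n, f i.castSucc := by
  rw [sum_filter, Fin.sum_univ_castSucc]
  simp [Fin.castSucc_lt_last]

theorem yjmEnd_castSucc_incl (n : ℕ) (j : Fin n) (v : V n) :
    yjmEnd (n + 1) j.castSucc (incl n v) = incl n (yjmEnd n j v) := by
  refine linearMap_ext (f := yjmEnd (n + 1) j.castSucc ∘ₗ incl n) (g := incl n ∘ₗ yjmEnd n j)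
    (fun X => ?_) v
  simp only [LinearMap.comp_apply, yjmEnd, LinearMap.sum_apply, map_sum, incl_single,
    permRep_single, sum_lt_castSucc, map_swap_castSucc]

theorem yjmEnd_castSucc_bar (n : ℕ) (j : Fin n) (v : V n) :
    yjmEnd (n + 1) j.castSucc (bar n v) = bar n (yjmEnd n j v) := by
  refine linearMap_ext (f := yjmEnd (n + 1) j.castSucc ∘ₗ bar n) (g := bar n ∘ₗ yjmEnd n j)
    (fun X => ?_) v
  simp only [LinearMap.comp_apply, yjmEnd, LinearMap.sum_apply, map_sum, bar_single,
    permRep_single, sum_lt_castSucc, map_insert, map_swap_castSucc]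
  refine sum_congr rfl fun i _ => ?_
  congr 2
  exact Equiv.swap_apply_of_ne_of_ne (Fin.castSucc_ne_last _).symm (Fin.castSucc_ne_last _).symm

theorem map_swap_of_mem_of_notMem {α : Type*} [DecidableEq α] (A : Finset α) {x y : α} (hx : x ∈ A)
    (hy : y ∉ A) : A.map (Equiv.swap x y).toEmbedding = insert y (A.erase x) := by
  ext z
  simp only [mem_map_equiv, Equiv.symm_swap, mem_insert, mem_erase]
  rw [Equiv.swap_apply_def]
  split_ifs with h1 h2
  · subst h1
    have : z ≠ y := fun h => hy (h ▸ hx)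
    simp [hy, this]
  · subst h2; simp [hx]
  · simp [h1, h2]

theorem map_swap_of_iff {α : Type*} [DecidableEq α] (A : Finset α) {x y : α} (h : x ∈ A ↔ y ∈ A) :
    A.map (Equiv.swap x y).toEmbedding = A := by
  ext z
  simp only [mem_map_equiv, Equiv.symm_swap]
  rw [Equiv.swap_apply_def]
  split_ifs with h1 h2
  · subst h1; exact h.symm
  · subst h2; exact h
  · rfl

/-- The transposition (x, n+1) fixes X when x ∉ X, which happens n - |X| times, and otherwise
replaces x by n+1. -/
theorem yjmEnd_last_incl (n : ℕ) (v : V n) :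
    yjmEnd (n + 1) (Fin.last n) (incl n v) =
      (n : ℂ) • incl n v - incl n (grade n v) + bar n (down n v) := by
  refine linearMap_ext (f := yjmEnd (n + 1) (Fin.last n) ∘ₗ incl n)
    (g := (n : ℂ) • incl n - incl n ∘ₗ grade n + bar n ∘ₗ down n) (fun X => ?_) v
  simp only [LinearMap.comp_apply, LinearMap.add_apply, LinearMap.sub_apply, LinearMap.smul_apply,
    yjmEnd, LinearMap.sum_apply, sum_lt_last, incl_single, permRep_single, grade_single,
    down_single, map_smul, map_sum, bar_single]
  rw [← sum_add_sum_compl X]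
  refine (add_comm _ _).trans ?_
  congr 1
  · rw [sum_congr rfl (g := fun _ => Finsupp.single (X.map Fin.castSuccEmb) (1 : ℂ))]
    · rw [sum_const, card_compl, Fintype.card_fin, ← Nat.cast_smul_eq_nsmul ℂ, Nat.cast_sub
        (by simpa using card_le_univ X), sub_smul]
    · intro x hx
      rw [map_swap_of_iff]
      simpa [Fin.castSucc_ne_last] using hx
  · refine sum_congr rfl fun x hx => ?_
    rw [map_swap_of_mem_of_notMem _ (by simpa using hx) (last_notMem n X), map_erase_castSucc]

/-- Here (x, n+1) fixes X ∪ {n+1} for the |X| elements x ∈ X, and for x ∉ X it replaces n+1 by x. -/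
theorem yjmEnd_last_bar (n : ℕ) (v : V n) :
    yjmEnd (n + 1) (Fin.last n) (bar n v) = bar n (grade n v) + incl n (up n v) := by
  refine linearMap_ext (f := yjmEnd (n + 1) (Fin.last n) ∘ₗ bar n)
    (g := bar n ∘ₗ grade n + incl n ∘ₗ up n) (fun X => ?_) v
  simp only [LinearMap.comp_apply, LinearMap.add_apply,
    yjmEnd, LinearMap.sum_apply, sum_lt_last, incl_single, permRep_single, grade_single,
    up_single, map_smul, map_sum, bar_single]
  rw [← sum_add_sum_compl X]
  congr 1
  · rw [sum_congr rfl
      (g := fun _ => Finsupp.single (insert (Fin.last n) (X.map Fin.castSuccEmb)) (1 : ℂ))]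
    · rw [sum_const, ← Nat.cast_smul_eq_nsmul ℂ]
    · intro x hx
      rw [map_swap_of_iff]
      simpa [Fin.castSucc_ne_last] using hx
  · refine sum_congr rfl fun x hx => ?_
    rw [Equiv.swap_comm, map_swap_of_mem_of_notMem _ (mem_insert_self _ _),
      erase_insert (last_notMem n X), map_insert]
    · rfl
    · simpa [Fin.castSucc_ne_last] using hx

theorem grade_of_mem_level {n r : ℕ} {v : V n} (h : v ∈ level n r) :
    grade n v = (r : ℂ) • v := by
  rw [level, Finsupp.mem_supported] at h
  conv_lhs => rw [← Finsupp.sum_single v]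
  conv_rhs => rw [← Finsupp.sum_single v]
  simp only [Finsupp.sum, map_sum, smul_sum]
  refine sum_congr rfl fun X hX => ?_
  have : X.card = r := h hX
  simp [grade, this, mul_comm]

theorem incl_mem_level {n r : ℕ} {v : V n} (h : v ∈ level n r) : incl n v ∈ level (n + 1) r := by
  have := Finsupp.lmapDomain_supported ℂ ℂ (fun X : Finset (Fin n) => X.map Fin.castSuccEmb)
    {X | X.card = r}
  refine Finsupp.supported_mono ?_ (this ▸ Submodule.mem_map_of_mem h)
  rintro _ ⟨X, hX, rfl⟩
  simpa using hX

theorem bar_mem_level {n r : ℕ} {v : V n} (h : v ∈ level n r) :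
    bar n v ∈ level (n + 1) (r + 1) := by
  have := Finsupp.lmapDomain_supported ℂ ℂ
    (fun X : Finset (Fin n) => insert (Fin.last n) (X.map Fin.castSuccEmb)) {X | X.card = r}
  refine Finsupp.supported_mono ?_ (this ▸ Submodule.mem_map_of_mem h)
  rintro _ ⟨X, hX, rfl⟩
  simpa [card_insert_of_notMem (last_notMem n X)] using hX

/-- The projection `V(B(n + 1)) → V(B(n))` that kills the sets containing `n + 1`. -/
noncomputable def proj (n : ℕ) : V (n + 1) →ₗ[ℂ] V n :=
  Finsupp.linearCombination ℂ fun X : Finset (Fin (n + 1)) =>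
    if Fin.last n ∈ X then 0 else Finsupp.single (univ.filter fun i => i.castSucc ∈ X) 1

theorem proj_incl (n : ℕ) (v : V n) : proj n (incl n v) = v := by
  refine linearMap_ext (f := proj n ∘ₗ incl n) (g := LinearMap.id) (fun X => ?_) v
  simp [incl_single, proj, Fin.castSucc_ne_last]

theorem proj_bar (n : ℕ) (v : V n) : proj n (bar n v) = 0 := by
  refine linearMap_ext (f := proj n ∘ₗ bar n) (g := 0) (fun X => ?_) v
  simp [bar_single, proj]

theorem bar_eq_zero {n : ℕ} {v : V n} (h : bar n v = 0) : v = 0 := by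
  have h1 := down_bar n v
  rw [h, map_zero] at h1
  have h2 := congrArg (proj n) h1
  simpa [proj_incl, proj_bar] using h2.symm

theorem eq_top_of_incl_mem_of_bar_mem {n : ℕ} {N : Submodule ℂ (V (n + 1))}
    (h1 : ∀ v, incl n v ∈ N) (h2 : ∀ v, bar n v ∈ N) : N = ⊤ := by
  rw [eq_top_iff]
  intro v _
  rw [← Finsupp.sum_single v]
  refine Submodule.sum_mem _ fun X _ => ?_
  rw [← mul_one (v X), ← smul_eq_mul, ← Finsupp.smul_single]
  refine Submodule.smul_mem _ _ ?_
  by_cases h : Fin.last n ∈ X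
  · have := h2 (Finsupp.single (univ.filter fun i : Fin n => i.castSucc ∈ X) 1)
    rw [bar_single] at this
    have hX : insert (Fin.last n) ((univ.filter fun i : Fin n => i.castSucc ∈ X).map Fin.castSuccEmb) = X := by
      ext x
      refine Fin.lastCases ?_ (fun i => ?_) x <;> simp [h, Fin.castSucc_ne_last]
    rwa [hX] at this
  · have := h1 (Finsupp.single (univ.filter fun i : Fin n => i.castSucc ∈ X) 1)
    rw [incl_single] at this
    have hX : (univ.filter fun i : Fin n => i.castSucc ∈ X).map Fin.castSuccEmb = X := by
      ext x
      refine Fin.lastCases ?_ (fun i => ?_) x <;> simp [h, Fin.castSucc_ne_last]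
    rwa [hX] at this

/-! ### Ballot words and their contents -/

/-- The number of `j` among the first `m` with `r j = 1`. -/
def ones {n : ℕ} (r : Fin n → ℕ) (m : ℕ) : ℕ :=
  (univ.filter fun i : Fin n => (i : ℕ) < m ∧ r i = 1).card

/-- The words in `0` and `1` that list the rows of a standard tableau with at most two rows. -/
def IsBallot {n : ℕ} (r : Fin n → ℕ) : Prop :=
  ∀ j : Fin n, r j ≤ 1 ∧ (r j = 1 → 2 * ones r j + 1 ≤ j)

/-- The content of the `j`-th box of the tableau with row word `r`. -/
def wordContent {n : ℕ} (r : Fin n → ℕ) (j : Fin n) : ℤ :=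
  if r j = 0 then (j : ℤ) - ones r j else (ones r j : ℤ) - 1

theorem ones_self {n : ℕ} (r : Fin n → ℕ) :
    ones r n = (univ.filter fun j => r j = 1).card := by
  simp [ones]

theorem ones_zero {n : ℕ} (r : Fin n → ℕ) : ones r 0 = 0 := by
  simp [ones]

theorem ones_succ {n : ℕ} (r : Fin n → ℕ) (j : Fin n) :
    ones r (j + 1) = ones r j + if r j = 1 then 1 else 0 := by
  unfold ones
  split_ifs with h
  · have : (univ.filter fun i : Fin n => (i : ℕ) < (j : ℕ) + 1 ∧ r i = 1) =
        insert j (univ.filter fun i : Fin n => (i : ℕ) < (j : ℕ) ∧ r i = 1) := by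
      ext i
      simp only [mem_filter, mem_univ, true_and, mem_insert]
      constructor
      · rintro ⟨h1, h2⟩
        rcases Nat.lt_succ_iff_lt_or_eq.1 h1 with h3 | h3
        · exact Or.inr ⟨h3, h2⟩
        · exact Or.inl (Fin.ext h3)
      · rintro (rfl | ⟨h1, h2⟩)
        · exact ⟨Nat.lt_succ_self _, h⟩
        · exact ⟨by omega, h2⟩
    rw [this, card_insert_of_notMem (by simp)]
  · rw [add_zero]
    congr 1
    ext i
    simp only [mem_filter, mem_univ, true_and]
    constructor
    · rintro ⟨h1, h2⟩
      rcases Nat.lt_succ_iff_lt_or_eq.1 h1 with h3 | h3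
      · exact ⟨h3, h2⟩
      · exact absurd (Fin.ext h3 ▸ h2) h
    · rintro ⟨h1, h2⟩
      exact ⟨by omega, h2⟩

theorem ones_congr {n : ℕ} {r r' : Fin n → ℕ} {m : ℕ}
    (h : ∀ i : Fin n, (i : ℕ) < m → r i = r' i) : ones r m = ones r' m := by
  unfold ones
  congr 1
  ext i
  simp only [mem_filter, mem_univ, true_and]
  constructor
  · rintro ⟨h1, h2⟩
    exact ⟨h1, h i h1 ▸ h2⟩
  · rintro ⟨h1, h2⟩
    exact ⟨h1, (h i h1).trans h2⟩

theorem ones_castSucc {n : ℕ} (r : Fin (n + 1) → ℕ) {m : ℕ} (hm : m ≤ n) :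
    ones (fun i : Fin n => r i.castSucc) m = ones r m := by
  unfold ones
  rw [← card_map (Fin.castSuccEmb (n := n))]
  congr 1
  ext x
  refine Fin.lastCases ?_ (fun i => ?_) x
  · simp [Fin.castSucc_ne_last]
    omega
  · simp

theorem ones_last {n : ℕ} (r : Fin (n + 1) → ℕ) :
    ones r (n + 1) =
      ones (fun i : Fin n => r i.castSucc) n + if r (Fin.last n) = 1 then 1 else 0 := by
  rw [ones_castSucc r le_rfl]
  exact ones_succ r (Fin.last n)

theorem wordContent_castSucc {n : ℕ} (r : Fin (n + 1) → ℕ) (j : Fin n) :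
    wordContent r j.castSucc = wordContent (fun i : Fin n => r i.castSucc) j := by
  unfold wordContent
  rw [ones_castSucc r j.2.le]
  rfl

theorem wordContent_last {n : ℕ} (r : Fin (n + 1) → ℕ) :
    wordContent r (Fin.last n) = if r (Fin.last n) = 0
      then (n : ℤ) - ones (fun i : Fin n => r i.castSucc) n
      else (ones (fun i : Fin n => r i.castSucc) n : ℤ) - 1 := by
  rw [ones_castSucc r le_rfl]
  rfl

theorem IsBallot.castSucc {n : ℕ} {r : Fin (n + 1) → ℕ} (hr : IsBallot r) :
    IsBallot fun i : Fin n => r i.castSucc := by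
  intro j
  rw [ones_castSucc r j.2.le]
  exact hr j.castSucc

theorem isBallot_of_castSucc {n : ℕ} {r : Fin (n + 1) → ℕ}
    (hr : IsBallot fun i : Fin n => r i.castSucc)
    (h : r (Fin.last n) ≤ 1 ∧
      (r (Fin.last n) = 1 → 2 * ones (fun i : Fin n => r i.castSucc) n + 1 ≤ n)) :
    IsBallot r := by
  intro j
  refine Fin.lastCases ?_ (fun i => ?_) j
  · rw [ones_castSucc r le_rfl] at h
    exact h
  · have := hr i
    rw [ones_castSucc r i.2.le] at this
    exact this

theorem IsBallot.two_mul_ones_le {n : ℕ} {r : Fin n → ℕ} (hr : IsBallot r) {m : ℕ} (hm : m ≤ n) :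
    2 * ones r m ≤ m := by
  induction m with
  | zero => simp [ones_zero]
  | succ m ih =>
    have h1 := ones_succ r ⟨m, hm⟩
    have h2 := (hr ⟨m, hm⟩).2
    have h3 := ih (by omega)
    simp only at h1 h2
    split_ifs at h1 with h4
    · have := h2 h4
      omega
    · omega

theorem IsBallot.last_cases {n : ℕ} {r : Fin (n + 1) → ℕ} (hr : IsBallot r) :
    (r (Fin.last n) = 0 ∧ ones r (n + 1) = ones (fun i : Fin n => r i.castSucc) n) ∨
    (r (Fin.last n) = 1 ∧ ones r (n + 1) = ones (fun i : Fin n => r i.castSucc) n + 1 ∧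
      2 * ones (fun i : Fin n => r i.castSucc) n + 1 ≤ n) := by
  have h1 := ones_last r
  have h2 := hr (Fin.last n)
  have h4 := ones_castSucc r le_rfl
  have h3 : r (Fin.last n) = 0 ∨ r (Fin.last n) = 1 := by omega
  rcases h3 with h | h
  · left
    simpa [h] using h1
  · right
    refine ⟨h, by simpa [h] using h1, ?_⟩
    have := h2.2 h
    rw [h4]
    exact this

/-! ### Chain vectors: recursion, raising, lowering, eigenvalues, spanning -/

theorem chainVec_eq_zero {n : ℕ} {r : Fin n → ℕ} (hr : IsBallot r) {l : ℕ}
    (h : l < ones r n ∨ n < l + ones r n) : chainVec n r l = 0 := by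
  cases n with
  | zero =>
    have : ones r 0 = 0 := ones_zero r
    simp only [chainVec]
    rw [if_neg (by omega)]
  | succ n =>
    rw [chainVec]
    simp only [← ones_self]
    rcases hr.last_cases with ⟨h1, h2⟩ | ⟨h1, h2, h3⟩
    · rw [if_pos h1, if_neg (by omega)]
    · rw [if_neg (by omega), if_neg (by omega)]

/-- The range test can be dropped because both terms vanish outside k ≤ l ≤ n+1-k. At l = 0 the
truncated `l - 1` is harmless: either k = 0 and the coefficient is zero, or x_0 = 0. The exceptional
case k = n-k is an instance too, since there x_{k+1} = 0. -/
theorem chainVec_first {n : ℕ} {r : Fin (n + 1) → ℕ} (hr : IsBallot r)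
    (h : r (Fin.last n) = 0) (l : ℕ) :
    chainVec (n + 1) r l = incl n (chainVec n (fun i => r i.castSucc) l) +
      ((l : ℂ) - (ones (fun i : Fin n => r i.castSucc) n : ℂ)) •
        bar n (chainVec n (fun i => r i.castSucc) (l - 1)) := by
  rw [chainVec]
  simp only [← ones_self]
  have h2 := hr.castSucc.two_mul_ones_le le_rfl
  rw [if_pos h]
  split_ifs with h1
  · rfl
  · rw [chainVec_eq_zero hr.castSucc (by omega), chainVec_eq_zero hr.castSucc (by omega)]
    simp

/-- Past the top rank the formula survives: the coefficient vanishes at l = n-k, and x_l itself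
beyond. It fails at l = k-1, where it would give -x_k, so the lower bound on `l` is needed. -/
theorem chainVec_second {n : ℕ} {r : Fin (n + 1) → ℕ} (hr : IsBallot r)
    (h : r (Fin.last n) = 1) {l : ℕ} (hl : ones (fun i : Fin n => r i.castSucc) n ≤ l) :
    chainVec (n + 1) r (l + 1) =
      ((n : ℂ) - (ones (fun i : Fin n => r i.castSucc) n : ℂ) - (l : ℂ)) •
        bar n (chainVec n (fun i => r i.castSucc) l) -
      incl n (chainVec n (fun i => r i.castSucc) (l + 1)) := by
  rw [chainVec]
  simp only [← ones_self]
  have h2 := hr.castSucc.two_mul_ones_le le_rfl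
  rw [if_neg (by omega)]
  split_ifs with h1
  · rw [Nat.add_sub_cancel]
    congr 2
    push_cast
    ring
  · rw [chainVec_eq_zero (l := l + 1) hr.castSucc (by omega)]
    by_cases h3 : l + ones (fun i : Fin n => r i.castSucc) n = n
    · have : ((n : ℂ) - (ones (fun i : Fin n => r i.castSucc) n : ℂ) - (l : ℂ)) = 0 := by
        rw [sub_sub, sub_eq_zero]
        exact_mod_cast (by omega :
          n = ones (fun i : Fin n => r i.castSucc) n + l)
      rw [this]
      simp
    · rw [chainVec_eq_zero (l := l) hr.castSucc (by omega)]
      simp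

theorem chainVec_mem_level {n : ℕ} {r : Fin n → ℕ} (hr : IsBallot r) (l : ℕ) :
    chainVec n r l ∈ level n l := by
  induction n generalizing l with
  | zero =>
    simp only [chainVec]
    split_ifs with h
    · exact Finsupp.single_mem_supported _ _ (by simp [h])
    · exact zero_mem _
  | succ n ih =>
    rcases hr.last_cases with ⟨h1, h2⟩ | ⟨h1, h2, h3⟩
    · rw [chainVec_first hr h1]
      refine add_mem (incl_mem_level (ih hr.castSucc l)) ?_
      rcases Nat.eq_zero_or_pos l with h | h
      · by_cases hk : ones (fun i : Fin n => r i.castSucc) n = 0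
        · simp [h, hk]
        · rw [chainVec_eq_zero hr.castSucc (by omega)]
          simp
      · obtain ⟨l, rfl⟩ : ∃ m, l = m + 1 := ⟨l - 1, by omega⟩
        exact Submodule.smul_mem _ _ (bar_mem_level (ih hr.castSucc l))
    · by_cases h : l ≤ ones (fun i : Fin n => r i.castSucc) n
      · rw [chainVec_eq_zero hr (by omega)]
        exact zero_mem _
      · obtain ⟨l, rfl⟩ : ∃ m, l = m + 1 := ⟨l - 1, by omega⟩
        rw [chainVec_second hr h1 (by omega)]
        exact sub_mem (Submodule.smul_mem _ _ (bar_mem_level (ih hr.castSucc l)))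
          (incl_mem_level (ih hr.castSucc (l + 1)))

theorem up_chainVec {n : ℕ} {r : Fin n → ℕ} (hr : IsBallot r) {l : ℕ} (hl : ones r n ≤ l) :
    up n (chainVec n r l) = chainVec n r (l + 1) := by
  induction n generalizing l with
  | zero =>
    by_cases h : l = 0
    · simp [chainVec, h, up_single]
    · simp [chainVec, h]
  | succ n ih =>
    rcases hr.last_cases with ⟨h1, h2⟩ | ⟨h1, h2, h3⟩
    · rw [chainVec_first hr h1, chainVec_first hr h1, map_add, map_smul, up_incl, up_bar,
        ih hr.castSucc (by omega), Nat.add_sub_cancel]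
      by_cases hk : l = ones (fun i : Fin n => r i.castSucc) n
      · rw [← hk]
        push_cast
        module
      · rw [ih hr.castSucc (by omega), show l - 1 + 1 = l by omega]
        push_cast
        module
    · obtain ⟨l, rfl⟩ : ∃ m, l = m + 1 := ⟨l - 1, by omega⟩
      rw [chainVec_second hr h1 (by omega), chainVec_second hr h1 (by omega), map_sub, map_smul,
        up_incl, up_bar, ih hr.castSucc (by omega), ih hr.castSucc (by omega)]
      push_cast
      module

theorem down_chainVec_zero {n : ℕ} {r : Fin n → ℕ} (hr : IsBallot r) :
    down n (chainVec n r 0) = 0 := by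
  induction n with
  | zero => simp [chainVec, down_single]
  | succ n ih =>
    rcases hr.last_cases with ⟨h1, h2⟩ | ⟨h1, h2, h3⟩
    · rw [chainVec_first hr h1]
      by_cases hk : ones (fun i : Fin n => r i.castSucc) n = 0
      · simp [hk, down_incl, ih hr.castSucc]
      · rw [chainVec_eq_zero hr.castSucc (by omega)]
        simp
    · rw [chainVec_eq_zero hr (by omega)]
      simp

/-- The sl₂ relation along a chain. The factor l+1-k vanishes at l = k-1, so the statement includes
that `down` kills the bottom vector of a chain with k > 0; `down_chainVec_zero` covers k = 0. -/
theorem down_chainVec {n : ℕ} {r : Fin n → ℕ} (hr : IsBallot r) (l : ℕ) :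
    down n (chainVec n r (l + 1)) =
      (((l : ℂ) + 1 - (ones r n : ℂ)) * ((n : ℂ) - (ones r n : ℂ) - (l : ℂ))) •
        chainVec n r l := by
  induction n generalizing l with
  | zero =>
    by_cases h : l = 0
    · simp [chainVec, h, ones_zero r]
    · simp [chainVec, h]
  | succ n ih =>
    rcases hr.last_cases with ⟨h1, h2⟩ | ⟨h1, h2, h3⟩
    · rw [chainVec_first hr h1, chainVec_first hr h1, map_add, map_smul, down_incl, down_bar,
        ih hr.castSucc, h2, Nat.add_sub_cancel]
      rcases Nat.eq_zero_or_pos l with h | h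
      · subst h
        rw [down_chainVec_zero hr.castSucc]
        by_cases hk : ones (fun i : Fin n => r i.castSucc) n = 0
        · rw [hk]
          simp only [map_smul, map_zero]
          push_cast
          module
        · rw [chainVec_eq_zero hr.castSucc (by omega)]
          simp
      · obtain ⟨l, rfl⟩ : ∃ m, l = m + 1 := ⟨l - 1, by omega⟩
        rw [ih hr.castSucc, Nat.add_sub_cancel, map_smul, map_smul]
        push_cast
        module
    · rw [h2]
      by_cases h : l ≤ ones (fun i : Fin n => r i.castSucc) n
      · rw [chainVec_eq_zero (l := l) hr (by omega)]
        by_cases h' : l < ones (fun i : Fin n => r i.castSucc) n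
        · rw [chainVec_eq_zero hr (by omega)]
          simp
        -- The bottom of the new chain: z_{k+1} = (n-2k) bar x_k - x_{k+1}, and the two
        -- contributions (n-2k) x_k cancel because `down` kills x_k.
        · have hl : l = ones (fun i : Fin n => r i.castSucc) n := by omega
          rw [chainVec_second hr h1 (by omega), map_sub, map_smul, down_incl, down_bar,
            ih hr.castSucc]
          have : down n (chainVec n (fun i => r i.castSucc) l) = 0 := by
            rcases Nat.eq_zero_or_pos l with h0 | h0
            · rw [h0, down_chainVec_zero hr.castSucc]
            · obtain ⟨m, rfl⟩ : ∃ m, l = m + 1 := ⟨l - 1, by omega⟩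
              rw [ih hr.castSucc, ← hl]
              push_cast
              simp
          rw [this, ← hl]
          simp only [map_smul, map_zero]
          module
      · obtain ⟨l, rfl⟩ : ∃ m, l = m + 1 := ⟨l - 1, by omega⟩
        rw [chainVec_second hr h1 (by omega), chainVec_second hr h1 (by omega), map_sub, map_smul,
          down_incl, down_bar, ih hr.castSucc, ih hr.castSucc, map_smul, map_smul]
        push_cast
        module

/-- The part without n+1 is ± x_l, nonzero by induction, except at the top of a first-row extension.
There only (n+1-2k) bar x_{n-k} remains. -/
theorem chainVec_ne_zero {n : ℕ} {r : Fin n → ℕ} (hr : IsBallot r) {l : ℕ}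
    (h1 : ones r n ≤ l) (h2 : l + ones r n ≤ n) : chainVec n r l ≠ 0 := by
  induction n generalizing l with
  | zero =>
    have : l = 0 := by omega
    simp [chainVec, this]
  | succ n ih =>
    intro h0
    rcases hr.last_cases with ⟨h3, h4⟩ | ⟨h3, h4, h5⟩
    · rw [chainVec_first hr h3] at h0
      by_cases h : l + ones (fun i : Fin n => r i.castSucc) n ≤ n
      · have := congrArg (proj n) h0
        rw [map_add, map_smul, proj_incl, proj_bar, smul_zero, add_zero, map_zero] at this
        exact ih hr.castSucc (by omega) h this
      · have h6 := hr.castSucc.two_mul_ones_le le_rfl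
        rw [chainVec_eq_zero (l := l) hr.castSucc (by omega), map_zero, zero_add,
          smul_eq_zero] at h0
        rcases h0 with h0 | h0
        · have : l = ones (fun i : Fin n => r i.castSucc) n := by
            exact_mod_cast sub_eq_zero.1 h0
          omega
        · exact ih hr.castSucc (by omega) (by omega) (bar_eq_zero h0)
    · obtain ⟨l, rfl⟩ : ∃ m, l = m + 1 := ⟨l - 1, by omega⟩
      rw [chainVec_second hr h3 (by omega)] at h0
      have := congrArg (proj n) h0
      rw [map_sub, map_smul, proj_incl, proj_bar, smul_zero, zero_sub, map_zero,
        neg_eq_zero] at this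
      exact ih hr.castSucc (by omega) (by omega) this

theorem yjmEnd_chainVec {n : ℕ} {r : Fin n → ℕ} (hr : IsBallot r) (l : ℕ) (j : Fin n) :
    yjmEnd n j (chainVec n r l) = (wordContent r j : ℂ) • chainVec n r l := by
  induction n generalizing l with
  | zero => exact j.elim0
  | succ n ih =>
    rcases hr.last_cases with ⟨h1, h2⟩ | ⟨h1, h2, h3⟩
    · refine Fin.lastCases ?_ (fun i => ?_) j
      · rw [wordContent_last, if_pos h1, chainVec_first hr h1, map_add, map_smul,
          yjmEnd_last_incl, yjmEnd_last_bar, grade_of_mem_level (chainVec_mem_level hr.castSucc _),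
          grade_of_mem_level (chainVec_mem_level hr.castSucc _)]
        rcases Nat.eq_zero_or_pos l with h | h
        · subst h
          rw [down_chainVec_zero hr.castSucc]
          by_cases hk : ones (fun i : Fin n => r i.castSucc) n = 0
          · rw [hk]
            simp
          · rw [chainVec_eq_zero hr.castSucc (by omega)]
            simp
        · obtain ⟨l, rfl⟩ : ∃ m, l = m + 1 := ⟨l - 1, by omega⟩
          rw [down_chainVec hr.castSucc, Nat.add_sub_cancel, map_smul, map_smul, map_smul]
          -- `up_chainVec` is only available from rank k on. Below it x_l = 0, and at rank l+1 = k
          -- the coefficient of the `bar` term vanishes.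
          by_cases h : l < ones (fun i : Fin n => r i.castSucc) n
          · rw [chainVec_eq_zero (l := l) hr.castSucc (by omega)]
            rcases Nat.lt_or_eq_of_le (Nat.succ_le_of_lt h) with h' | h'
            · rw [chainVec_eq_zero hr.castSucc (by omega)]
              simp
            · have : (ones (fun i : Fin n => r i.castSucc) n : ℂ) = l + 1 := by
                rw [← h']; push_cast; ring
              rw [this]
              push_cast
              simp only [this, map_zero]
              module
          · rw [up_chainVec hr.castSucc (by omega)]
            push_cast
            module
      · rw [wordContent_castSucc, chainVec_first hr h1, map_add, map_smul, yjmEnd_castSucc_incl,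
          yjmEnd_castSucc_bar, ih hr.castSucc, ih hr.castSucc, map_smul, map_smul]
        module
    · by_cases h : l ≤ ones (fun i : Fin n => r i.castSucc) n
      · rw [chainVec_eq_zero hr (by omega)]
        simp
      obtain ⟨l, rfl⟩ : ∃ m, l = m + 1 := ⟨l - 1, by omega⟩
      refine Fin.lastCases ?_ (fun i => ?_) j
      · rw [wordContent_last, if_neg (by omega), chainVec_second hr h1 (by omega), map_sub,
          map_smul, yjmEnd_last_incl, yjmEnd_last_bar,
          grade_of_mem_level (chainVec_mem_level hr.castSucc _),
          grade_of_mem_level (chainVec_mem_level hr.castSucc _), down_chainVec hr.castSucc,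
          up_chainVec hr.castSucc (by omega)]
        simp only [map_smul]
        push_cast
        module
      · rw [wordContent_castSucc, chainVec_second hr h1 (by omega), map_sub, map_smul,
          yjmEnd_castSucc_incl, yjmEnd_castSucc_bar, ih hr.castSucc, ih hr.castSucc, map_smul,
          map_smul]
        module

theorem chainVec_span (n : ℕ) :
    Submodule.span ℂ {v | ∃ (r : Fin n → ℕ) (l : ℕ), IsBallot r ∧ v = chainVec n r l} = ⊤ := by
  induction n with
  | zero =>
    rw [eq_top_iff]
    intro v _
    have hv : v = v ∅ • chainVec 0 Fin.elim0 0 := by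
      refine Finsupp.ext fun X => ?_
      have : X = ∅ := Subsingleton.elim _ _
      simp [this, chainVec]
    rw [hv]
    exact Submodule.smul_mem _ _ (Submodule.subset_span ⟨_, _, fun j => j.elim0, rfl⟩)
  | succ n ih =>
    set N := Submodule.span ℂ
      {v | ∃ (r : Fin (n + 1) → ℕ) (l : ℕ), IsBallot r ∧ v = chainVec (n + 1) r l} with hN
    have key : ∀ (r : Fin n → ℕ) (l : ℕ), IsBallot r →
        incl n (chainVec n r l) ∈ N ∧ bar n (chainVec n r l) ∈ N := by
      intro r l hr
      by_cases hl : l < ones r n ∨ n < l + ones r n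
      · rw [chainVec_eq_zero hr hl]
        simp
      have hk := hr.two_mul_ones_le le_rfl
      have e : ∀ a : ℕ, (fun i : Fin n => (Fin.snoc r a : Fin (n + 1) → ℕ) i.castSucc) = r :=
        fun a => by ext i; simp
      have b0 : IsBallot (Fin.snoc r 0 : Fin (n + 1) → ℕ) :=
        isBallot_of_castSucc (by rw [e]; exact hr) (by simp)
      have y : ∀ l, incl n (chainVec n r l) +
          ((l : ℂ) - (ones r n : ℂ)) • bar n (chainVec n r (l - 1)) ∈ N := by
        intro l
        have := chainVec_first b0 (by simp) l
        rw [e] at this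
        rw [← this]
        exact Submodule.subset_span ⟨_, _, b0, rfl⟩
      have hb : ∀ l, ones r n ≤ l → l + ones r n ≤ n → bar n (chainVec n r l) ∈ N := by
        intro l h1 h2
        have y1 := y (l + 1)
        rw [Nat.add_sub_cancel] at y1
        rcases Nat.lt_or_eq_of_le h2 with h3 | h3
        · have b1 : IsBallot (Fin.snoc r 1 : Fin (n + 1) → ℕ) :=
            isBallot_of_castSucc (by rw [e]; exact hr) (by rw [e]; simp; omega)
          have z := chainVec_second b1 (by simp) (l := l) (by rw [e]; exact h1)
          rw [e] at z
          have z1 : chainVec (n + 1) (Fin.snoc r 1) (l + 1) ∈ N :=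
            Submodule.subset_span ⟨_, _, b1, rfl⟩
          -- In y_{l+1} + z_{l+1} the `incl` parts cancel and the coefficients of bar x_l add to
          -- n+1-2k, which is positive.
          have s := add_mem y1 (z ▸ z1)
          have hc : ((n + 1 - 2 * ones r n : ℕ) : ℂ) ≠ 0 := by
            rw [Nat.cast_ne_zero]; omega
          rw [Nat.cast_sub (by omega)] at hc
          rw [← N.smul_mem_iff hc]
          convert s using 1
          push_cast
          module
        · rw [chainVec_eq_zero hr (by omega), map_zero, zero_add] at y1
          refine (N.smul_mem_iff ?_).1 y1
          rw [sub_ne_zero, Nat.cast_injective.ne_iff]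
          omega
      refine ⟨?_, hb l (by omega) (by omega)⟩
      rcases Nat.lt_or_eq_of_le (show ones r n ≤ l by omega) with h | h
      · have := sub_mem (y l) (N.smul_mem ((l : ℂ) - (ones r n : ℂ))
          (hb (l - 1) (by omega) (by omega)))
        simpa using this
      · have := y l
        rw [h] at this
        simpa using this
    refine eq_top_of_incl_mem_of_bar_mem (fun v => ?_) (fun v => ?_)
    · have : (⊤ : Submodule ℂ (V n)) ≤ N.comap (incl n) := by
        rw [← ih, Submodule.span_le]
        rintro _ ⟨r, l, hr, rfl⟩
        exact (key r l hr).1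
      exact this trivial
    · have : (⊤ : Submodule ℂ (V n)) ≤ N.comap (bar n) := by
        rw [← ih, Submodule.span_le]
        rintro _ ⟨r, l, hr, rfl⟩
        exact (key r l hr).2
      exact this trivial

/-! ### Families of operators whose joint eigenvalues separate a family of vectors -/

section JointEigenvectors

variable {ι κ M : Type*} [AddCommGroup M] [Module ℂ M]

/-- Descent on the support: if s and t both lie in the support of f, some operator separates them,
and subtracting c_t f from its value on f removes t from the support but keeps s. -/
theorem exists_single_mem_of_separating {c : ι → κ → ℂ}
    (hsep : ∀ s t, (∀ j, c s j = c t j) → s = t) {K : Submodule ℂ (ι →₀ ℂ)}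
    (hstab : ∀ j, ∀ f ∈ K, ∃ g ∈ K, ∀ t, g t = c t j * f t) (hK : K ≠ ⊥) :
    ∃ t, Finsupp.single t 1 ∈ K := by
  have key : ∀ (d : ℕ) (f : ι →₀ ℂ), f ∈ K → f ≠ 0 → f.support.card = d →
      ∃ t, Finsupp.single t 1 ∈ K := by
    intro d
    induction d using Nat.strong_induction_on with
    | _ d ih =>
      intro f hf hf0 hd
      obtain ⟨t, ht⟩ := Finsupp.support_nonempty_iff.2 hf0
      by_cases h : ∃ s ∈ f.support, s ≠ t
      · obtain ⟨s, hs, hst⟩ := h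
        obtain ⟨j, hj⟩ := not_forall.1 fun h => hst (hsep s t h)
        obtain ⟨g, hg, hgt⟩ := hstab j f hf
        have hv : ∀ u, (g - c t j • f) u = (c u j - c t j) * f u := by
          intro u
          simp [hgt u, sub_mul]
        refine ih _ ?_ (g - c t j • f) (sub_mem hg (K.smul_mem _ hf)) ?_ rfl
        · rw [← hd]
          refine Finset.card_lt_card ((Finset.ssubset_iff_of_subset ?_).2 ⟨t, ht, ?_⟩)
          · intro u hu
            rw [Finsupp.mem_support_iff, hv] at hu
            exact Finsupp.mem_support_iff.2 (right_ne_zero_of_mul hu)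
          · rw [Finsupp.mem_support_iff, hv]
            simp
        · intro h0
          have := hv s
          rw [h0] at this
          exact mul_ne_zero (sub_ne_zero.2 hj) (Finsupp.mem_support_iff.1 hs) this.symm
      · push Not at h
        refine ⟨t, ?_⟩
        have hft := Finsupp.mem_support_iff.1 ht
        have : f = f t • Finsupp.single t 1 := by
          refine Finsupp.ext fun u => ?_
          by_cases hu : u = t
          · simp [hu]
          · have : f u = 0 := by
              by_contra h0
              exact hu (h u (Finsupp.mem_support_iff.2 h0))
            simp [this, Ne.symm hu]
        rw [this] at hf
        exact (K.smul_mem_iff hft).1 hf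
  obtain ⟨f, hf, hf0⟩ := (Submodule.ne_bot_iff K).1 hK
  exact key _ f hf hf0 rfl

/-- Lifts the operator to coefficients. Independence of `b` is not assumed, so that the lift can be
applied to the kernel of relations in order to prove independence. -/
theorem exists_linearCombination_eq {b : ι → M} {A : M →ₗ[ℂ] M} {c : ι → ℂ}
    (hA : ∀ t, A (b t) = c t • b t) (f : ι →₀ ℂ) :
    ∃ g : ι →₀ ℂ, (∀ t, g t = c t * f t) ∧
      Finsupp.linearCombination ℂ b g = A (Finsupp.linearCombination ℂ b f) := by
  induction f using Finsupp.induction_linear with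
  | zero => exact ⟨0, by simp⟩
  | add f₁ f₂ h₁ h₂ =>
    obtain ⟨g₁, h₁, h₁'⟩ := h₁
    obtain ⟨g₂, h₂, h₂'⟩ := h₂
    exact ⟨g₁ + g₂, by simp [h₁, h₂, mul_add], by simp [h₁', h₂']⟩
  | single t a =>
    refine ⟨Finsupp.single t (c t * a), fun s => ?_, ?_⟩
    · by_cases h : s = t
      · simp [h]
      · simp [Ne.symm h]
    · rw [Finsupp.linearCombination_single, Finsupp.linearCombination_single, map_smul, hA,
        smul_smul, mul_comm]

theorem exists_mem_of_separating {b : ι → M} {A : κ → M →ₗ[ℂ] M} {c : ι → κ → ℂ}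
    (hA : ∀ t j, A j (b t) = c t j • b t) (hsep : ∀ s t, (∀ j, c s j = c t j) → s = t)
    {N : Submodule ℂ M} (hN : N ≤ Submodule.span ℂ (Set.range b))
    (hstab : ∀ j, N ≤ N.comap (A j)) (h0 : N ≠ ⊥) : ∃ t, b t ∈ N := by
  have := exists_single_mem_of_separating (K := N.comap (Finsupp.linearCombination ℂ b)) hsep
    (fun j f hf => ?_) ?_
  · obtain ⟨t, ht⟩ := this
    exact ⟨t, by simpa using ht⟩
  · obtain ⟨g, hg, hg'⟩ := exists_linearCombination_eq (A := A j) (fun t => hA t j) f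
    refine ⟨g, ?_, hg⟩
    rw [Submodule.mem_comap, hg']
    exact hstab j hf
  · obtain ⟨v, hv, hv0⟩ := (Submodule.ne_bot_iff N).1 h0
    obtain ⟨f, hf⟩ := (Finsupp.mem_span_range_iff_exists_finsupp).1 (hN hv)
    refine (Submodule.ne_bot_iff _).2 ⟨f, ?_, ?_⟩
    · rw [Submodule.mem_comap, Finsupp.linearCombination_apply, hf]
      exact hv
    · rintro rfl
      exact hv0 (by simpa using hf.symm)

theorem linearIndependent_of_separating {b : ι → M} {A : κ → M →ₗ[ℂ] M} {c : ι → κ → ℂ}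
    (hA : ∀ t j, A j (b t) = c t j • b t) (hsep : ∀ s t, (∀ j, c s j = c t j) → s = t)
    (hb : ∀ t, b t ≠ 0) : LinearIndependent ℂ b := by
  rw [linearIndependent_iff_ker]
  by_contra h
  have hstab : ∀ j, ∀ f ∈ LinearMap.ker (Finsupp.linearCombination ℂ b),
      ∃ g ∈ LinearMap.ker (Finsupp.linearCombination ℂ b), ∀ t, g t = c t j * f t := by
    intro j f hf
    obtain ⟨g, hg, hg'⟩ := exists_linearCombination_eq (A := A j) (fun t => hA t j) f
    refine ⟨g, ?_, hg⟩
    rw [LinearMap.mem_ker] at hf ⊢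
    rw [hg', hf, map_zero]
  obtain ⟨t, ht⟩ := exists_single_mem_of_separating hsep hstab h
  exact hb t (by simpa using ht)

theorem mem_span_of_jointEigenvector {b : ι → M} {A : κ → M →ₗ[ℂ] M} {c : ι → κ → ℂ}
    (hA : ∀ t j, A j (b t) = c t j • b t) (hb : LinearIndependent ℂ b) {v : M}
    (hv : v ∈ Submodule.span ℂ (Set.range b)) {χ : κ → ℂ} (hχ : ∀ j, A j v = χ j • v) :
    v ∈ Submodule.span ℂ (b '' {t | ∀ j, c t j = χ j}) := by
  obtain ⟨f, hf⟩ := (Finsupp.mem_span_range_iff_exists_finsupp).1 hv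
  rw [Finsupp.mem_span_image_iff_linearCombination]
  refine ⟨f, ?_, hf⟩
  rw [Finsupp.mem_supported]
  intro t ht j
  obtain ⟨g, hg, hg'⟩ := exists_linearCombination_eq (A := A j) (fun t => hA t j) f
  rw [Finsupp.linearCombination_apply ℂ f, hf, hχ j, ← hf, ← Finsupp.linearCombination_apply,
    ← map_smul] at hg'
  have h2 := hg t
  rw [hb hg', Finsupp.smul_apply, smul_eq_mul] at h2
  exact (mul_right_cancel₀ (Finsupp.mem_support_iff.1 ht) h2).symm

end JointEigenvectors

/-! ### Adjacent transpositions against the Young–Jucys–Murphy elements -/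

section Swap

theorem permRep_mul_apply (n : ℕ) (g h : Equiv.Perm (Fin n)) (v : V n) :
    permRep n (g * h) v = permRep n g (permRep n h v) := by
  rw [map_mul]; rfl

theorem permRep_grade (n : ℕ) (g : Equiv.Perm (Fin n)) (v : V n) :
    grade n (permRep n g v) = permRep n g (grade n v) := by
  refine linearMap_ext (f := grade n ∘ₗ permRep n g) (g := permRep n g ∘ₗ grade n)
    (fun X => ?_) v
  simp only [LinearMap.comp_apply, grade_single, permRep_single, map_smul, card_map]

theorem permRep_swap_swap {n : ℕ} (i j : Fin n) (v : V n) :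
    permRep n (Equiv.swap i j) (permRep n (Equiv.swap i j) v) = v := by
  rw [← permRep_mul_apply, Equiv.swap_mul_self, map_one]
  rfl

theorem permRep_yjmEnd {n : ℕ} (g : Equiv.Perm (Fin n)) (p : Fin n) (v : V n) :
    permRep n g (yjmEnd n p v) =
      ∑ i : Fin n with i < p, permRep n (Equiv.swap (g i) (g p)) (permRep n g v) := by
  simp only [yjmEnd, LinearMap.sum_apply, map_sum, ← permRep_mul_apply,
    Equiv.mul_swap_eq_swap_mul]

theorem permRep_swap_yjmEnd_of_ne {n : ℕ} {j j' p : Fin n} (hj : (j' : ℕ) = j + 1) (h : p ≠ j)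
    (h' : p ≠ j') (v : V n) :
    permRep n (Equiv.swap j j') (yjmEnd n p v) = yjmEnd n p (permRep n (Equiv.swap j j') v) := by
  rw [permRep_yjmEnd, Equiv.swap_apply_of_ne_of_ne h h', yjmEnd, LinearMap.sum_apply]
  refine sum_equiv (Equiv.swap j j') (fun i => ?_) (fun i _ => rfl)
  have h1 : (p : ℕ) ≠ j := fun h0 => h (Fin.ext h0)
  have h2 : (p : ℕ) ≠ j' := fun h0 => h' (Fin.ext h0)
  simp only [mem_filter, mem_univ, true_and]
  rw [Equiv.swap_apply_def]
  split_ifs with h3 h4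
  · subst h3; rw [Fin.lt_def, Fin.lt_def]; omega
  · subst h4; rw [Fin.lt_def, Fin.lt_def]; omega
  · rfl

/-- Conjugation by s = (j, j+1) carries Y_{j+1} to the sum of (i, j) over i < j plus s itself; the
last term meets s² = 1. -/
theorem permRep_swap_yjmEnd_right {n : ℕ} {j j' : Fin n} (hj : (j' : ℕ) = j + 1) (v : V n) :
    permRep n (Equiv.swap j j') (yjmEnd n j' v) =
      yjmEnd n j (permRep n (Equiv.swap j j') v) + v := by
  have hf : (univ.filter fun i : Fin n => i < j') = insert j (univ.filter fun i => i < j) := by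
    ext i
    simp only [mem_filter, mem_univ, true_and, mem_insert, Fin.ext_iff, Fin.lt_def]
    omega
  rw [permRep_yjmEnd, Equiv.swap_apply_right, hf, sum_insert (by simp), Equiv.swap_apply_left,
    Equiv.swap_comm j' j, permRep_swap_swap, add_comm, yjmEnd, LinearMap.sum_apply]
  congr 1
  refine sum_congr rfl fun i hi => ?_
  simp only [mem_filter, mem_univ, true_and, Fin.lt_def] at hi
  rw [Equiv.swap_apply_of_ne_of_ne] <;> rw [Ne, Fin.ext_iff] <;> omega

theorem permRep_swap_yjmEnd_left {n : ℕ} {j j' : Fin n} (hj : (j' : ℕ) = j + 1) (v : V n) :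
    permRep n (Equiv.swap j j') (yjmEnd n j v) =
      yjmEnd n j' (permRep n (Equiv.swap j j') v) - v := by
  have h := permRep_swap_yjmEnd_right hj (permRep n (Equiv.swap j j') v)
  rw [permRep_swap_swap] at h
  have h2 := congrArg (permRep n (Equiv.swap j j')) h
  rw [permRep_swap_swap, map_add, permRep_swap_swap] at h2
  rw [h2, add_sub_cancel_right]

theorem swap_sub_smul_jointEigenvector {n : ℕ} {j j' : Fin n} (hj : (j' : ℕ) = j + 1) {v : V n}
    {χ : Fin n → ℂ} (hv : ∀ p, yjmEnd n p v = χ p • v) (hne : χ j' - χ j ≠ 0) (p : Fin n) :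
    yjmEnd n p (permRep n (Equiv.swap j j') v - (χ j' - χ j)⁻¹ • v) =
      χ (Equiv.swap j j' p) • (permRep n (Equiv.swap j j') v - (χ j' - χ j)⁻¹ • v) := by
  rw [map_sub, map_smul, hv p]
  by_cases h : p = j
  · subst h
    have := permRep_swap_yjmEnd_right hj v
    rw [hv, map_smul] at this
    rw [Equiv.swap_apply_left, ← sub_eq_iff_eq_add.2 this, smul_sub, smul_smul, smul_smul,
      sub_sub, ← one_smul ℂ v, smul_smul, smul_smul, ← add_smul, one_smul]
    congr 2
    field_simp
    ring
  by_cases h' : p = j'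
  · subst h'
    have := permRep_swap_yjmEnd_left hj v
    rw [hv, map_smul] at this
    rw [Equiv.swap_apply_right, eq_sub_iff_add_eq.1 this |>.symm]
    have e : (χ p - χ j)⁻¹ * χ p = 1 + χ j * (χ p - χ j)⁻¹ := by
      field_simp
      ring
    rw [smul_sub, smul_smul, smul_smul, e, add_smul, one_smul]
    abel
  · rw [Equiv.swap_apply_of_ne_of_ne h h', ← permRep_swap_yjmEnd_of_ne hj h h', hv p, map_smul,
      smul_sub, smul_comm]

end Swap

/-! ### S_m-invariance and irreducibility as conditions on subspaces -/

section Invariance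

/-- `N` is stable under `S_m`. -/
def IsInvariant (n m : ℕ) (N : Submodule ℂ (V n)) : Prop :=
  ∀ g ∈ symSubgroup n m, N ≤ N.comap (permRep n g)

theorem mem_symSubgroup {n m : ℕ} {g : Equiv.Perm (Fin n)} :
    g ∈ symSubgroup n m ↔ ∀ j : Fin n, m ≤ (j : ℕ) → g j = j := by
  simp [symSubgroup, mem_fixingSubgroup_iff]

theorem swap_mem_symSubgroup {n m : ℕ} {i j : Fin n} (hi : (i : ℕ) < m) (hj : (j : ℕ) < m) :
    Equiv.swap i j ∈ symSubgroup n m := by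
  rw [mem_symSubgroup]
  intro p hp
  exact Equiv.swap_apply_of_ne_of_ne (by rintro rfl; omega) (by rintro rfl; omega)

/-- A group generated by transpositions contains every permutation of finite support that preserves
its orbits; here all points below m lie in the orbit of 0. -/
theorem symSubgroup_le_closure (n m : ℕ) :
    symSubgroup n m ≤ Subgroup.closure {g | ∃ j j' : Fin n, (j' : ℕ) = j + 1 ∧ (j' : ℕ) < m ∧
      g = Equiv.swap j j'} := by
  set S : Set (Equiv.Perm (Fin n)) := {g | ∃ j j' : Fin n, (j' : ℕ) = j + 1 ∧ (j' : ℕ) < m ∧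
    g = Equiv.swap j j'} with hS
  have key : ∀ (k : ℕ) (hk : k < n), k < m →
      (⟨k, hk⟩ : Fin n) ∈ MulAction.orbit (Subgroup.closure S) (⟨0, by omega⟩ : Fin n) := by
    intro k
    induction k with
    | zero => intro _ _; exact MulAction.mem_orbit_self _
    | succ k ih =>
      intro hk hm
      obtain ⟨⟨g, hg⟩, hgk⟩ := ih (by omega) (by omega)
      have hs : Equiv.swap (⟨k, by omega⟩ : Fin n) ⟨k + 1, hk⟩ ∈ Subgroup.closure S :=
        Subgroup.subset_closure ⟨_, _, rfl, hm, rfl⟩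
      refine ⟨⟨_, mul_mem hs hg⟩, ?_⟩
      have hgk : g ⟨0, by omega⟩ = ⟨k, by omega⟩ := hgk
      change Equiv.swap (⟨k, by omega⟩ : Fin n) ⟨k + 1, hk⟩ (g ⟨0, by omega⟩) = _
      rw [hgk, Equiv.swap_apply_left]
  intro g hg
  rw [mem_symSubgroup] at hg
  rw [mem_closure_isSwap]
  · refine ⟨Set.toFinite _, fun x => ?_⟩
    by_cases hx : m ≤ (x : ℕ)
    · rw [hg x hx]
      exact MulAction.mem_orbit_self _
    · have hgx : (g x : ℕ) < m := by
        by_contra h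
        have := g.injective (hg (g x) (by omega))
        rw [this] at h
        omega
      have h1 := key x x.2 (by omega)
      have h2 := key (g x) (g x).2 hgx
      rw [← MulAction.orbit_eq_iff] at h1 h2 ⊢
      exact h2.trans h1.symm
  · rintro _ ⟨j, j', h1, h2, rfl⟩
    exact ⟨j, j', fun h => by rw [h] at h1; omega, rfl⟩

theorem isInvariant_of_adjacent {n m : ℕ} {N : Submodule ℂ (V n)}
    (h : ∀ j j' : Fin n, (j' : ℕ) = j + 1 → (j' : ℕ) < m →
      N ≤ N.comap (permRep n (Equiv.swap j j'))) : IsInvariant n m N := by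
  intro g hg
  -- Carrying g⁻¹ along settles the inversion step of the closure induction.
  have : N ≤ N.comap (permRep n g) ∧ N ≤ N.comap (permRep n g⁻¹) := by
    refine Subgroup.closure_induction (p := fun g _ => N ≤ N.comap (permRep n g) ∧
      N ≤ N.comap (permRep n g⁻¹)) ?_ ?_ ?_ ?_ (symSubgroup_le_closure n m hg)
    · rintro _ ⟨j, j', h1, h2, rfl⟩
      rw [Equiv.swap_inv]
      exact ⟨h j j' h1 h2, h j j' h1 h2⟩
    · rw [inv_one, map_one]
      exact ⟨fun v hv => hv, fun v hv => hv⟩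
    · rintro a b _ _ ⟨ha, ha'⟩ ⟨hb, hb'⟩
      rw [mul_inv_rev, map_mul, map_mul]
      exact ⟨fun v hv => ha (hb hv), fun v hv => hb' (ha' hv)⟩
    · rintro a _ ⟨ha, ha'⟩
      rw [inv_inv]
      exact ⟨ha', ha⟩
  exact this.1

theorem IsInvariant.yjmEnd {n m : ℕ} {N : Submodule ℂ (V n)} (hN : IsInvariant n m N) {p : Fin n}
    (hp : (p : ℕ) < m) : N ≤ N.comap (yjmEnd n p) := by
  intro v hv
  rw [Submodule.mem_comap, Johnson.yjmEnd, LinearMap.sum_apply]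
  refine Submodule.sum_mem _ fun i hi => ?_
  simp only [mem_filter, mem_univ, true_and, Fin.lt_def] at hi
  exact hN _ (swap_mem_symSubgroup (by omega) hp) hv

theorem isIrreducibleSubmodule_iff {n m : ℕ} {N : Submodule ℂ (V n)} :
    IsIrreducibleSubmodule n m N ↔ IsInvariant n m N ∧ N ≠ ⊥ ∧
      ∀ N' ≤ N, IsInvariant n m N' → N' ≠ ⊥ → N' = N := by
  constructor
  · rintro ⟨h, hirr⟩
    refine ⟨fun g hg => h ⟨g, hg⟩, ?_, ?_⟩
    · rintro rfl
      obtain ⟨a, b, hab⟩ := hirr.exists_pair_ne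
      refine hab (Subrepresentation.toSubmodule_injective ?_)
      exact Subsingleton.elim _ _
    · intro N' hle hinv hne
      let a : Subrepresentation (Representation.subrepresentation
          ((permRep n).comp (symSubgroup n m).subtype) N h) :=
        ⟨N'.comap N.subtype, fun g v hv => hinv g.1 g.2 hv⟩
      rcases hirr.eq_bot_or_eq_top a with ha | ha
      · exfalso
        have ha : N'.comap N.subtype = ⊥ := congrArg Subrepresentation.toSubmodule ha
        refine hne ?_
        rw [Submodule.eq_bot_iff]
        intro v hv
        have : (⟨v, hle hv⟩ : N) ∈ N'.comap N.subtype := hv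
        rw [ha, Submodule.mem_bot] at this
        exact congrArg Subtype.val this
      · have ha : N'.comap N.subtype = ⊤ := congrArg Subrepresentation.toSubmodule ha
        refine le_antisymm hle fun v hv => ?_
        have : (⟨v, hv⟩ : N) ∈ N'.comap N.subtype := ha ▸ trivial
        exact this
  · rintro ⟨hinv, hne, hirr⟩
    refine ⟨fun g => hinv g.1 g.2, { exists_pair_ne := ⟨⊥, ⊤, ?_⟩, eq_bot_or_eq_top := ?_ }⟩
    · intro h
      have h : (⊥ : Submodule ℂ N) = ⊤ := congrArg Subrepresentation.toSubmodule h
      refine hne ((Submodule.eq_bot_iff _).2 fun v hv => ?_)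
      have : (⟨v, hv⟩ : N) ∈ (⊥ : Submodule ℂ N) := h ▸ trivial
      exact congrArg Subtype.val ((Submodule.mem_bot ℂ).1 this)
    · intro a
      by_cases ha : a.toSubmodule = ⊥
      · exact Or.inl (Subrepresentation.toSubmodule_injective ha)
      · right
        refine Subrepresentation.toSubmodule_injective ?_
        have := hirr (a.toSubmodule.map N.subtype) (Submodule.map_subtype_le _ _) ?_ ?_
        · change a.toSubmodule = ⊤
          rw [eq_top_iff]
          rintro ⟨v, hv⟩ _
          obtain ⟨w, hw, hwv⟩ : v ∈ a.toSubmodule.map N.subtype := this.symm ▸ hv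
          have : w = ⟨v, hv⟩ := Subtype.ext hwv
          exact this ▸ hw
        · rintro g hg _ ⟨w, hw, rfl⟩
          exact ⟨_, a.apply_mem_toSubmodule ⟨g, hg⟩ hw, rfl⟩
        · intro h
          refine ha ((Submodule.eq_bot_iff _).2 fun w hw => Subtype.ext ?_)
          have : (w : V n) ∈ a.toSubmodule.map N.subtype := ⟨w, hw, rfl⟩
          rw [h] at this
          exact (Submodule.mem_bot ℂ).1 this

end Invariance

/-! ### Combinatorics of ballot words: contents, admissible swaps, sorting -/

section Words

variable {n : ℕ} {r r' : Fin n → ℕ}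

theorem IsBallot.eq_zero_or_one (hr : IsBallot r) (j : Fin n) : r j = 0 ∨ r j = 1 := by
  have := (hr j).1
  omega

/-- With o earlier ones, a box added to the second row has content o-1 and one added to the first
row has j-o; equality would contradict 2o+1 ≤ j. -/
theorem eq_of_wordContent_eq (hr : IsBallot r) (hr' : IsBallot r') {j : Fin n}
    (h : ones r j = ones r' j) (hc : wordContent r j = wordContent r' j) : r j = r' j := by
  have h1 := (hr j).2
  have h2 := (hr' j).2
  unfold wordContent at hc
  rcases hr.eq_zero_or_one j with h3 | h3 <;> rcases hr'.eq_zero_or_one j with h4 | h4 <;>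
    simp [h3, h4] at hc h1 h2 ⊢ <;> omega

theorem eq_of_wordContent_eq_of_lt (hr : IsBallot r) (hr' : IsBallot r') {m : ℕ}
    (hc : ∀ j : Fin n, (j : ℕ) < m → wordContent r j = wordContent r' j) (j : Fin n)
    (hj : (j : ℕ) < m) : r j = r' j := by
  obtain ⟨q, hq⟩ := j
  induction q using Nat.strong_induction_on with
  | _ q ih =>
    refine eq_of_wordContent_eq hr hr' (ones_congr fun i hi => ?_) (hc _ hj)
    have hi : (i : ℕ) < q := hi
    have hj : q < m := hj
    exact ih i hi i.2 (by simp; omega)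

theorem ones_add_ones {m q : ℕ} (h : ∀ p : Fin n, m ≤ (p : ℕ) → r p = r' p) (hm : m ≤ q)
    (hq : q ≤ n) : ones r q + ones r' m = ones r' q + ones r m := by
  induction q, hm using Nat.le_induction with
  | base => exact add_comm _ _
  | succ q hmq ih =>
    have h1 := ones_succ r ⟨q, hq⟩
    have h2 := ones_succ r' ⟨q, hq⟩
    have h3 := h ⟨q, hq⟩ hmq
    have h4 := ih (by omega)
    simp only at h1 h2
    rw [h3] at h1
    omega

theorem eq_of_wordContent_eq_of_le (hr : IsBallot r) (hr' : IsBallot r') {m : ℕ}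
    (h : ones r m = ones r' m)
    (hc : ∀ j : Fin n, m ≤ (j : ℕ) → wordContent r j = wordContent r' j) {q : ℕ} (hm : m ≤ q)
    (hq : q ≤ n) : ones r q = ones r' q := by
  induction q, hm using Nat.le_induction with
  | base => exact h
  | succ q hmq ih =>
    have h1 := ones_succ r ⟨q, hq⟩
    have h2 := ones_succ r' ⟨q, hq⟩
    have h4 := ih (by omega)
    have h3 := eq_of_wordContent_eq hr hr' (j := ⟨q, hq⟩) h4 (hc _ hmq)
    simp only at h1 h2
    rw [h3] at h1
    omega

theorem wordContent_ne (hr : IsBallot r) {j j' : Fin n} (hj : (j' : ℕ) = j + 1) :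
    wordContent r j ≠ wordContent r j' := by
  have h1 := (hr j).2
  have h2 := (hr j').2
  have h5 := ones_succ r j
  have h6 := hr.two_mul_ones_le (m := j) j.2.le
  unfold wordContent
  rw [hj] at h2 ⊢
  rcases hr.eq_zero_or_one j with h3 | h3 <;> rcases hr.eq_zero_or_one j' with h4 | h4 <;>
    simp [h3, h4] at h1 h2 h5 ⊢ <;> omega

/-- Equal contents before j give equal prefixes; a case check on the two exchanged letters shows
that the counts of ones agree again after j', and from there equal contents force equal letters. -/
theorem eq_of_swapped_wordContent (hr : IsBallot r) (hr' : IsBallot r') {j j' : Fin n}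
    (hj : (j' : ℕ) = j + 1) (hc : ∀ p, wordContent r' p = wordContent r (Equiv.swap j j' p)) :
    ones r' n = ones r n ∧ ∀ p : Fin n, (j' : ℕ) < p → r' p = r p := by
  have hlow : ∀ p : Fin n, (p : ℕ) < j → r' p = r p := by
    refine eq_of_wordContent_eq_of_lt hr' hr fun p hp => ?_
    rw [hc, Equiv.swap_apply_of_ne_of_ne] <;> rw [Ne, Fin.ext_iff] <;> omega
  have hk : ones r' j = ones r j := ones_congr hlow
  have hmid : ones r' (j' + 1) = ones r (j' + 1) := by
    have c1 := hc j
    have c2 := hc j'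
    rw [Equiv.swap_apply_left] at c1
    rw [Equiv.swap_apply_right] at c2
    have a1 := (hr j).2
    have a2 := (hr j').2
    have a3 := (hr' j).2
    have a4 := (hr' j').2
    have a5 := ones_succ r j
    have a6 := ones_succ r j'
    have a7 := ones_succ r' j
    have a8 := ones_succ r' j'
    have a9 := hr.two_mul_ones_le (m := j) j.2.le
    unfold wordContent at c1 c2
    rw [hj] at a2 a4 a6 a8 c1 c2 ⊢
    rcases hr.eq_zero_or_one j with h1 | h1 <;> rcases hr.eq_zero_or_one j' with h2 | h2 <;>
    rcases hr'.eq_zero_or_one j with h3 | h3 <;> rcases hr'.eq_zero_or_one j' with h4 | h4 <;>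
      simp only [h1, h2, h3, h4, if_true, if_false, one_ne_zero, zero_ne_one, forall_const,
        IsEmpty.forall_iff, hk] at a1 a2 a3 a4 a5 a6 a7 a8 c1 c2 <;> omega
  have hc' : ∀ p : Fin n, (j' : ℕ) + 1 ≤ p → wordContent r' p = wordContent r p := by
    intro p hp
    rw [hc, Equiv.swap_apply_of_ne_of_ne] <;> rw [Ne, Fin.ext_iff] <;> omega
  have key : ∀ q, (j' : ℕ) + 1 ≤ q → q ≤ n → ones r' q = ones r q := fun q h1 h2 =>
    eq_of_wordContent_eq_of_le hr' hr hmid hc' h1 h2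
  exact ⟨key n j'.2 le_rfl, fun p hp => eq_of_wordContent_eq hr' hr (key p hp p.2.le) (hc' p hp)⟩

section SwapWord

variable {j j' : Fin n}

theorem ones_swap_of_le {q : ℕ} (hj : (j' : ℕ) = j + 1) (hq : q ≤ j) :
    ones (r ∘ Equiv.swap j j') q = ones r q := by
  refine ones_congr fun i hi => ?_
  rw [Function.comp_apply, Equiv.swap_apply_of_ne_of_ne] <;> rw [Ne, Fin.ext_iff] <;> omega

theorem ones_swap_mid (hj : (j' : ℕ) = j + 1) (h0 : r j' = 0) :
    ones (r ∘ Equiv.swap j j') j' = ones r j := by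
  have := ones_succ (r ∘ Equiv.swap j j') j
  rw [Function.comp_apply, Equiv.swap_apply_left, h0, ones_swap_of_le hj le_rfl] at this
  simpa [hj] using this

theorem ones_swap_of_lt {q : ℕ} (hj : (j' : ℕ) = j + 1) (h1 : r j = 1) (h0 : r j' = 0)
    (hq : (j' : ℕ) < q) (hqn : q ≤ n) : ones (r ∘ Equiv.swap j j') q = ones r q := by
  have a1 := ones_succ (r ∘ Equiv.swap j j') j'
  have a2 := ones_succ r j
  have a3 := ones_succ r j'
  rw [Function.comp_apply, Equiv.swap_apply_right, h1, ones_swap_mid hj h0] at a1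
  rw [h1] at a2
  rw [h0] at a3
  have a4 := ones_add_ones (r := r ∘ Equiv.swap j j') (r' := r) (m := j' + 1) (fun p hp => by
    rw [Function.comp_apply, Equiv.swap_apply_of_ne_of_ne] <;> rw [Ne, Fin.ext_iff] <;> omega)
    hq hqn
  rw [← hj] at a2
  simp at a1 a2 a3
  omega

theorem IsBallot.swap (hr : IsBallot r) (hj : (j' : ℕ) = j + 1) (h1 : r j = 1) (h0 : r j' = 0) :
    IsBallot (r ∘ Equiv.swap j j') := by
  intro p
  refine ⟨(hr _).1, ?_⟩
  rcases lt_trichotomy (p : ℕ) j with h | h | h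
  · rw [ones_swap_of_le hj h.le, Function.comp_apply, Equiv.swap_apply_of_ne_of_ne]
    · exact (hr p).2
    · rw [Ne, Fin.ext_iff]; omega
    · rw [Ne, Fin.ext_iff]; omega
  · obtain rfl : p = j := Fin.ext h
    simp [h0]
  · rcases Nat.lt_or_eq_of_le (Nat.succ_le_of_lt h) with h' | h'
    · rw [ones_swap_of_lt hj h1 h0 (by omega) p.2.le, Function.comp_apply,
        Equiv.swap_apply_of_ne_of_ne]
      · exact (hr p).2
      · rw [Ne, Fin.ext_iff]; omega
      · rw [Ne, Fin.ext_iff]; omega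
    · obtain rfl : p = j' := Fin.ext (by omega)
      rw [ones_swap_mid hj h0]
      have := (hr j).2 h1
      omega

theorem wordContent_swap (hj : (j' : ℕ) = j + 1) (h1 : r j = 1) (h0 : r j' = 0) (p : Fin n) :
    wordContent (r ∘ Equiv.swap j j') p = wordContent r (Equiv.swap j j' p) := by
  rcases lt_trichotomy (p : ℕ) j with h | h | h
  · unfold wordContent
    rw [ones_swap_of_le hj h.le, Function.comp_apply, Equiv.swap_apply_of_ne_of_ne]
    · rw [Ne, Fin.ext_iff]; omega
    · rw [Ne, Fin.ext_iff]; omega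
  · obtain rfl : p = j := Fin.ext h
    have a2 := ones_succ r p
    rw [h1] at a2
    unfold wordContent
    rw [Function.comp_apply, Equiv.swap_apply_left, h0, ones_swap_of_le hj le_rfl, hj, a2]
    simp
  · rcases Nat.lt_or_eq_of_le (Nat.succ_le_of_lt h) with h' | h'
    · unfold wordContent
      rw [ones_swap_of_lt hj h1 h0 (by omega) p.2.le, Function.comp_apply,
        Equiv.swap_apply_of_ne_of_ne]
      · rw [Ne, Fin.ext_iff]; omega
      · rw [Ne, Fin.ext_iff]; omega
    · obtain rfl : p = j' := Fin.ext (by omega)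
      unfold wordContent
      rw [ones_swap_mid hj h0, Function.comp_apply, Equiv.swap_apply_right, h1]
      simp

/-- The weight n-p decreases to the right, so moving a one to the right lowers the sum. This is the
termination measure for sorting. -/
theorem sum_swap_lt (hj : (j' : ℕ) = j + 1) (h1 : r j = 1) (h0 : r j' = 0) :
    ∑ p : Fin n, (n - (p : ℕ)) * (r ∘ Equiv.swap j j') p < ∑ p : Fin n, (n - (p : ℕ)) * r p := by
  have : ∑ p : Fin n, (n - (p : ℕ)) * (r ∘ Equiv.swap j j') p =
      ∑ p : Fin n, (n - (Equiv.swap j j' p : ℕ)) * r p := by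
    rw [← Equiv.sum_comp (Equiv.swap j j')]
    simp
  rw [this]
  refine sum_lt_sum (fun p _ => ?_) ⟨j, mem_univ _, ?_⟩
  · rw [Equiv.swap_apply_def]
    split_ifs with h h'
    · subst h
      exact Nat.mul_le_mul_right _ (by omega)
    · subst h'
      simp [h0]
    · rfl
  · rw [Equiv.swap_apply_left, h1]
    have := j'.2
    omega

end SwapWord

/-- Only 10 → 01 is used, since the reverse move can break the ballot condition. As `P` is
transported by an equivalence, two words can be compared through their common sorted form. -/
theorem exists_sorted_word {m : ℕ} {P : (Fin n → ℕ) → Prop}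
    (hP : ∀ r, IsBallot r → ∀ j j' : Fin n, (j' : ℕ) = j + 1 → (j' : ℕ) < m → r j = 1 → r j' = 0 →
      (P r ↔ P (r ∘ Equiv.swap j j'))) (hr : IsBallot r) :
    ∃ r₀, IsBallot r₀ ∧ ones r₀ n = ones r n ∧ (∀ p : Fin n, m ≤ (p : ℕ) → r₀ p = r p) ∧
      (∀ j j' : Fin n, (j' : ℕ) = j + 1 → (j' : ℕ) < m → r₀ j ≤ r₀ j') ∧ (P r ↔ P r₀) := by
  obtain ⟨d, hd⟩ : ∃ d, d = ∑ p : Fin n, (n - (p : ℕ)) * r p := ⟨_, rfl⟩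
  induction d using Nat.strong_induction_on generalizing r with
  | _ d ih =>
    by_cases h : ∀ j j' : Fin n, (j' : ℕ) = j + 1 → (j' : ℕ) < m → r j ≤ r j'
    · exact ⟨r, hr, rfl, fun _ _ => rfl, h, Iff.rfl⟩
    · push Not at h
      obtain ⟨j, j', hj, hm, hlt⟩ := h
      have h1 : r j = 1 := by have := (hr j).1; omega
      have h0 : r j' = 0 := by omega
      obtain ⟨r₀, a1, a2, a3, a4, a5⟩ := ih _ (hd ▸ sum_swap_lt hj h1 h0) (hr.swap hj h1 h0) rfl
      refine ⟨r₀, a1, a2.trans (ones_swap_of_lt hj h1 h0 j'.2 le_rfl), fun p hp => ?_, a4,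
        (hP r hr j j' hj hm h1 h0).trans a5⟩
      rw [a3 p hp, Function.comp_apply, Equiv.swap_apply_of_ne_of_ne] <;>
        rw [Ne, Fin.ext_iff] <;> omega

theorem le_of_sorted_word {m : ℕ}
    (h : ∀ j j' : Fin n, (j' : ℕ) = j + 1 → (j' : ℕ) < m → r j ≤ r j') {i j : Fin n}
    (hij : i ≤ j) (hj : (j : ℕ) < m) : r i ≤ r j := by
  have key : ∀ (q : ℕ) (hq : q < n), (i : ℕ) ≤ q → q < m → r i ≤ r ⟨q, hq⟩ := by
    intro q hq hiq
    induction q, hiq using Nat.le_induction with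
    | base => intro _; exact le_rfl
    | succ q _ ih =>
      intro hm
      exact (ih (by omega) (by omega)).trans (h ⟨q, by omega⟩ ⟨q + 1, hq⟩ rfl hm)
  exact key j j.2 hij hj

theorem sorted_word_unique {m : ℕ} (hr : IsBallot r) (hr' : IsBallot r')
    (h : ∀ j j' : Fin n, (j' : ℕ) = j + 1 → (j' : ℕ) < m → r j ≤ r j')
    (h' : ∀ j j' : Fin n, (j' : ℕ) = j + 1 → (j' : ℕ) < m → r' j ≤ r' j')
    (ht : ∀ p : Fin n, m ≤ (p : ℕ) → r p = r' p) (ho : ones r n = ones r' n) : r = r' := by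
  have key : ∀ {r r' : Fin n → ℕ}, IsBallot r → IsBallot r' →
      (∀ j j' : Fin n, (j' : ℕ) = j + 1 → (j' : ℕ) < m → r j ≤ r j') →
      (∀ j j' : Fin n, (j' : ℕ) = j + 1 → (j' : ℕ) < m → r' j ≤ r' j') →
      (∀ p : Fin n, m ≤ (p : ℕ) → r p = r' p) → ones r n = ones r' n →
      ∀ i, r i = 0 → r' i ≠ 1 := by
    intro r r' hr hr' h h' ht ho i hi hi'
    have him : (i : ℕ) < m := by
      by_contra hm
      have := ht i (by omega)
      omega
    rw [ones_self, ones_self] at ho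
    -- By sortedness the ones of `r` below m lie to the right of i, where `r'` is also one; so the
    -- ones of `r` form a proper subset of those of `r'`, against equal counts.
    refine ho.not_lt (card_lt_card ((ssubset_iff_of_subset ?_).2 ⟨i, by simp [hi'], by simp [hi]⟩))
    intro p hp
    simp only [mem_filter, mem_univ, true_and] at hp ⊢
    by_cases hm : m ≤ (p : ℕ)
    · rw [← ht p hm, hp]
    · rcases le_total p i with hpi | hpi
      · have := le_of_sorted_word h hpi him
        omega
      · have := le_of_sorted_word h' hpi (by omega)
        have := (hr' p).1
        omega
  funext i
  have k1 := key hr hr' h h' ht ho i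
  have k2 := key hr' hr h' h (fun p hp => (ht p hp).symm) ho.symm i
  have := hr.eq_zero_or_one i
  have := hr'.eq_zero_or_one i
  omega

theorem iff_of_swap_invariant {m : ℕ} {P : (Fin n → ℕ) → Prop}
    (hP : ∀ r, IsBallot r → ∀ j j' : Fin n, (j' : ℕ) = j + 1 → (j' : ℕ) < m → r j = 1 → r j' = 0 →
      (P r ↔ P (r ∘ Equiv.swap j j'))) (hr : IsBallot r) (hr' : IsBallot r')
    (ho : ones r n = ones r' n) (ht : ∀ p : Fin n, m ≤ (p : ℕ) → r p = r' p) : P r ↔ P r' := by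
  obtain ⟨s, a1, a2, a3, a4, a5⟩ := exists_sorted_word hP hr
  obtain ⟨s', b1, b2, b3, b4, b5⟩ := exists_sorted_word hP hr'
  have : s = s' := sorted_word_unique a1 b1 a4 b4
    (fun p hp => by rw [a3 p hp, b3 p hp, ht p hp]) (by rw [a2, b2, ho])
  rw [a5, b5, this]

end Words

/-! ### The chain vectors as a joint eigenbasis and the action of adjacent transpositions -/

section JointBasis

/-- The indices of the members of all the chains: a row word and a rank. -/
abbrev ChainIndex (n : ℕ) : Type :=
  {q : (Fin n → ℕ) × ℕ // IsBallot q.1 ∧ ones q.1 n ≤ q.2 ∧ q.2 + ones q.1 n ≤ n}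

/-- The grading operator together with the Young–Jucys–Murphy elements. -/
noncomputable def gradedYjm (n : ℕ) : Option (Fin n) → V n →ₗ[ℂ] V n
  | none => grade n
  | some j => yjmEnd n j

/-- The joint eigenvalues of the members of the chains. -/
def chainEigenvalue {n : ℕ} (q : (Fin n → ℕ) × ℕ) : Option (Fin n) → ℂ
  | none => q.2
  | some j => wordContent q.1 j

theorem gradedYjm_chainVec {n : ℕ} {r : Fin n → ℕ} (hr : IsBallot r) (l : ℕ)
    (j : Option (Fin n)) :
    gradedYjm n j (chainVec n r l) = chainEigenvalue (r, l) j • chainVec n r l := by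
  cases j with
  | none => exact grade_of_mem_level (chainVec_mem_level hr l)
  | some j => exact yjmEnd_chainVec hr l j

theorem linearIndependent_chainVec (n : ℕ) :
    LinearIndependent ℂ fun q : ChainIndex n => chainVec n q.1.1 q.1.2 := by
  refine linearIndependent_of_separating (A := gradedYjm n)
    (c := fun q => chainEigenvalue q.1) (fun q j => gradedYjm_chainVec q.2.1 _ j) ?_
    fun q => chainVec_ne_zero q.2.1 q.2.2.1 q.2.2.2
  rintro ⟨⟨r, l⟩, h, _⟩ ⟨⟨r', l'⟩, h', _⟩ hc
  have h1 : l = l' := by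
    have := hc none
    simpa [chainEigenvalue] using this
  have h2 : r = r' := by
    funext j
    refine eq_of_wordContent_eq_of_lt h h' (m := n) (fun p _ => ?_) j j.2
    have := hc (some p)
    simpa [chainEigenvalue] using this
  subst h1 h2
  rfl

theorem span_range_chainVec (n : ℕ) :
    Submodule.span ℂ (Set.range fun q : ChainIndex n => chainVec n q.1.1 q.1.2) = ⊤ := by
  rw [eq_top_iff, ← chainVec_span n, Submodule.span_le]
  rintro _ ⟨r, l, hr, rfl⟩
  by_cases h : l < ones r n ∨ n < l + ones r n
  · rw [chainVec_eq_zero hr h]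
    exact zero_mem _
  · push Not at h
    exact Submodule.subset_span ⟨⟨(r, l), hr, h.1, h.2⟩, rfl⟩

variable {n : ℕ} {r : Fin n → ℕ} {l : ℕ} {j j' : Fin n}

theorem swap_chainVec_mem_span (hr : IsBallot r) (hj : (j' : ℕ) = j + 1) :
    permRep n (Equiv.swap j j') (chainVec n r l) -
        ((wordContent r j' : ℂ) - wordContent r j)⁻¹ • chainVec n r l ∈
      Submodule.span ℂ ((fun r' => chainVec n r' l) ''
        {r' | IsBallot r' ∧ ∀ p, wordContent r' p = wordContent r (Equiv.swap j j' p)}) := by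
  have hne : (wordContent r j' : ℂ) - wordContent r j ≠ 0 := by
    rw [sub_ne_zero]
    exact fun h => wordContent_ne hr hj (Int.cast_injective h).symm
  have := mem_span_of_jointEigenvector (A := gradedYjm n)
    (c := fun q : ChainIndex n => chainEigenvalue q.1) (fun q j => gradedYjm_chainVec q.2.1 _ j)
    (linearIndependent_chainVec n)
    (v := permRep n (Equiv.swap j j') (chainVec n r l) -
        ((wordContent r j' : ℂ) - wordContent r j)⁻¹ • chainVec n r l)
    (by rw [span_range_chainVec]; trivial)
    (χ := fun p => p.elim (l : ℂ) fun p => (wordContent r (Equiv.swap j j' p) : ℂ)) (fun p => ?_)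
  · refine Submodule.span_mono ?_ this
    rintro _ ⟨⟨⟨r', l'⟩, h, _⟩, hc, rfl⟩
    have h1 : l' = l := by
      have := hc none
      simpa [chainEigenvalue] using this
    subst h1
    refine ⟨r', ⟨h, fun p => ?_⟩, rfl⟩
    have := hc (some p)
    simpa [chainEigenvalue] using this
  · cases p with
    | none =>
      change grade n _ = (l : ℂ) • _
      rw [map_sub, map_smul, permRep_grade, grade_of_mem_level (chainVec_mem_level hr l),
        map_smul, smul_sub, smul_comm]
    | some p =>
      exact swap_sub_smul_jointEigenvector hj (χ := fun p => (wordContent r p : ℂ))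
        (fun p => yjmEnd_chainVec hr l p) hne p

theorem two_le_wordContent_sub (hr : IsBallot r) (hj : (j' : ℕ) = j + 1) (h1 : r j = 1)
    (h0 : r j' = 0) : 2 ≤ wordContent r j' - wordContent r j := by
  have a1 := (hr j).2 h1
  have a2 := ones_succ r j
  rw [h1] at a2
  unfold wordContent
  rw [h0, h1, hj]
  simp only [if_true, one_ne_zero, if_false] at a2 ⊢
  omega

/-- Write v, w for the two vectors and s v = d⁻¹ v + β w with d the content difference. Applying s
again gives (1 - d⁻²) v = d⁻¹ β w + β s w. Since d ≥ 2, the left factor is nonzero, hence so is β,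
and each vector is obtained from the other. -/
theorem chainVec_mem_iff_swap {N : Submodule ℂ (V n)} (hr : IsBallot r) (hl : ones r n ≤ l)
    (hl' : l + ones r n ≤ n) (hj : (j' : ℕ) = j + 1) (h1 : r j = 1) (h0 : r j' = 0)
    (hN : N ≤ N.comap (permRep n (Equiv.swap j j'))) :
    chainVec n r l ∈ N ↔ chainVec n (r ∘ Equiv.swap j j') l ∈ N := by
  set d : ℂ := (wordContent r j' : ℂ) - wordContent r j with hd
  obtain ⟨β, hβ⟩ : ∃ β : ℂ, β • chainVec n (r ∘ Equiv.swap j j') l =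
      permRep n (Equiv.swap j j') (chainVec n r l) - d⁻¹ • chainVec n r l := by
    rw [← Submodule.mem_span_singleton]
    refine Submodule.span_mono ?_ (swap_chainVec_mem_span hr hj)
    rintro _ ⟨r', ⟨hr', hc⟩, rfl⟩
    have : r' = r ∘ Equiv.swap j j' := by
      funext p
      refine eq_of_wordContent_eq_of_lt hr' (hr.swap hj h1 h0) (m := n) (fun q _ => ?_) p p.2
      rw [hc, wordContent_swap hj h1 h0]
    rw [this]
    rfl
  have hs : permRep n (Equiv.swap j j') (chainVec n r l) =
      d⁻¹ • chainVec n r l + β • chainVec n (r ∘ Equiv.swap j j') l := by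
    rw [hβ]; abel
  have hss : chainVec n r l = d⁻¹ • permRep n (Equiv.swap j j') (chainVec n r l) +
      β • permRep n (Equiv.swap j j') (chainVec n (r ∘ Equiv.swap j j') l) := by
    rw [← map_smul, ← map_smul, ← map_add, ← hs, permRep_swap_swap]
  have hd1 : 1 - d⁻¹ * d⁻¹ ≠ 0 := by
    have h2 := two_le_wordContent_sub hr hj h1 h0
    have hdz : d = ((wordContent r j' - wordContent r j : ℤ) : ℂ) := by push_cast; rfl
    generalize wordContent r j' - wordContent r j = z at h2 hdz
    intro h
    have hz0 : d ≠ 0 := by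
      rw [hdz, Int.cast_ne_zero]; omega
    have : d * d = 1 := by
      field_simp at h
      linear_combination h
    rw [hdz] at this
    have : z * z = 1 := by exact_mod_cast this
    nlinarith
  have hss' : (1 - d⁻¹ * d⁻¹) • chainVec n r l =
      (d⁻¹ * β) • chainVec n (r ∘ Equiv.swap j j') l +
      β • permRep n (Equiv.swap j j') (chainVec n (r ∘ Equiv.swap j j') l) := by
    rw [sub_smul, one_smul, sub_eq_iff_eq_add]
    conv_lhs => rw [hss, hs]
    module
  have hβ0 : β ≠ 0 := by
    rintro rfl
    rw [mul_zero, zero_smul, zero_smul, add_zero, smul_eq_zero] at hss'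
    rcases hss' with h | h
    · exact hd1 h
    · exact chainVec_ne_zero hr hl hl' h
  constructor
  · intro h
    rw [← N.smul_mem_iff hβ0, hβ]
    exact sub_mem (hN h) (N.smul_mem _ h)
  · intro h
    rw [← N.smul_mem_iff hd1, hss']
    exact add_mem (N.smul_mem _ h) (N.smul_mem _ (hN h))

end JointBasis

/-! ### Class spans, their irreducibility, and Gelfand–Tsetlin subspaces -/

section GelfandTsetlin

variable {n m : ℕ} {r : Fin n → ℕ} {l : ℕ}

/-- The row words with the same shape as `r` that agree with `r` from `m` on. -/
def wordClass (n m : ℕ) (r : Fin n → ℕ) : Set (Fin n → ℕ) :=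
  {r' | IsBallot r' ∧ ones r' n = ones r n ∧ ∀ p : Fin n, m ≤ (p : ℕ) → r' p = r p}

/-- The span of the rank `l` members of the chains whose row words lie in `wordClass n m r`. -/
noncomputable def classSpan (n m : ℕ) (r : Fin n → ℕ) (l : ℕ) : Submodule ℂ (V n) :=
  Submodule.span ℂ (Set.range fun t : wordClass n m r => chainVec n t l)

theorem self_mem_wordClass (hr : IsBallot r) : r ∈ wordClass n m r :=
  ⟨hr, rfl, fun _ _ => rfl⟩

theorem chainVec_mem_classSpan {r' : Fin n → ℕ} (h : r' ∈ wordClass n m r) :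
    chainVec n r' l ∈ classSpan n m r l :=
  Submodule.subset_span ⟨⟨r', h⟩, rfl⟩

theorem classSpan_invariant (n m : ℕ) (r : Fin n → ℕ) (l : ℕ) :
    IsInvariant n m (classSpan n m r l) := by
  refine isInvariant_of_adjacent fun j j' hj hm => ?_
  refine Submodule.span_le.2 ?_
  rintro _ ⟨⟨t, ht⟩, rfl⟩
  have h := swap_chainVec_mem_span (l := l) ht.1 hj
  have h' : _ ∈ classSpan n m r l := Submodule.span_le.2 ?_ h
  · have := add_mem h' ((classSpan n m r l).smul_mem
      ((wordContent t j' : ℂ) - wordContent t j)⁻¹ (chainVec_mem_classSpan (l := l) ht))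
    rw [sub_add_cancel] at this
    exact this
  · rintro _ ⟨r', ⟨hr', hc⟩, rfl⟩
    obtain ⟨h1, h2⟩ := eq_of_swapped_wordContent ht.1 hr' hj hc
    exact chainVec_mem_classSpan ⟨hr', h1.trans ht.2.1,
      fun p hp => (h2 p (by omega)).trans (ht.2.2 p hp)⟩

theorem classSpan_le_of_mem {N : Submodule ℂ (V n)} (hN : IsInvariant n m N) (hr : IsBallot r)
    (hl : ones r n ≤ l) (hl' : l + ones r n ≤ n) (h : chainVec n r l ∈ N) :
    classSpan n m r l ≤ N := by
  refine Submodule.span_le.2 ?_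
  rintro _ ⟨⟨t, ht⟩, rfl⟩
  -- The guard on the number of ones keeps `l` within the ranks of the chain, where the vectors are
  -- nonzero.
  have := (iff_of_swap_invariant (m := m)
    (P := fun r' => ones r' n = ones r n → chainVec n r' l ∈ N) ?_ hr ht.1 ht.2.1.symm
    (fun p hp => (ht.2.2 p hp).symm)).1 (fun _ => h)
  · exact this ht.2.1
  · intro s hs j j' hj hm h1 h0
    rw [ones_swap_of_lt hj h1 h0 j'.2 le_rfl]
    refine imp_congr_right fun ho => ?_
    exact chainVec_mem_iff_swap hs (by omega) (by omega) hj h1 h0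
      (hN _ (swap_mem_symSubgroup (by omega) hm))

/-- The case m' = m serves irreducibility, the case m' = m+1 the multiplicity-free restriction from
S_{m+1} to S_m. -/
theorem exists_chainVec_mem {m' : ℕ} (hm : m' ≤ m + 1) {N : Submodule ℂ (V n)} (hN : IsInvariant n m N) (h0 : N ≠ ⊥)
    (hle : N ≤ classSpan n m' r l) :
    ∃ t ∈ wordClass n m' r, chainVec n t l ∈ N := by
  have hsep : ∀ s t : wordClass n m' r, (∀ p : {p : Fin n // (p : ℕ) < m},
      (wordContent s.1 p.1 : ℂ) = wordContent t.1 p.1) → s = t := by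
    rintro ⟨s, hs⟩ ⟨t, ht⟩ hc
    have hlow : ∀ p : Fin n, (p : ℕ) < m → s p = t p :=
      eq_of_wordContent_eq_of_lt hs.1 ht.1 fun p hp => by
        have := hc ⟨p, hp⟩
        simpa using this
    have hhigh : ∀ p : Fin n, m + 1 ≤ (p : ℕ) → s p = t p := fun p hp =>
      (hs.2.2 p (hm.trans hp)).trans (ht.2.2 p (hm.trans hp)).symm
    refine Subtype.ext (funext fun p => ?_)
    rcases lt_trichotomy (p : ℕ) m with h | h | h
    · exact hlow p h
    · subst h
      -- No available operator sees position m, but its letter is forced by the common total number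
      -- of ones.
      have a1 := ones_add_ones hhigh p.2 le_rfl
      have a2 := ones_succ s p
      have a3 := ones_succ t p
      rw [hs.2.1, ht.2.1] at a1
      rw [ones_congr hlow] at a2
      rcases hs.1.eq_zero_or_one p with h1 | h1 <;> rcases ht.1.eq_zero_or_one p with h2 | h2 <;>
        simp [h1, h2] at a2 a3 ⊢ <;> omega
    · exact hhigh p h
  obtain ⟨⟨t, ht⟩, htN⟩ := exists_mem_of_separating
    (b := fun t : wordClass n m' r => chainVec n t l)
    (A := fun p : {p : Fin n // (p : ℕ) < m} => yjmEnd n p.1)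
    (fun t p => yjmEnd_chainVec t.2.1 l p.1) hsep hle (fun p => hN.yjmEnd p.2) h0
  exact ⟨t, ht, htN⟩

theorem wordClass_mono {m' : ℕ} (h : m ≤ m') (r : Fin n → ℕ) :
    wordClass n m r ⊆ wordClass n m' r := fun _ ht =>
  ⟨ht.1, ht.2.1, fun p hp => ht.2.2 p (h.trans hp)⟩

theorem classSpan_mono {m' : ℕ} (h : m ≤ m') (r : Fin n → ℕ) (l : ℕ) :
    classSpan n m r l ≤ classSpan n m' r l := by
  refine Submodule.span_le.2 ?_
  rintro _ ⟨⟨t, ht⟩, rfl⟩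
  exact chainVec_mem_classSpan (wordClass_mono h r ht)

theorem classSpan_eq {r' : Fin n → ℕ} (h : r' ∈ wordClass n m r) :
    classSpan n m r' l = classSpan n m r l := by
  have : wordClass n m r' = wordClass n m r := by
    ext t
    constructor
    · rintro ⟨h1, h2, h3⟩
      exact ⟨h1, h2.trans h.2.1, fun p hp => (h3 p hp).trans (h.2.2 p hp)⟩
    · rintro ⟨h1, h2, h3⟩
      exact ⟨h1, h2.trans h.2.1.symm, fun p hp => (h3 p hp).trans (h.2.2 p hp).symm⟩
  unfold classSpan
  rw [this]

theorem classSpan_ne_bot (hr : IsBallot r) (hl : ones r n ≤ l) (hl' : l + ones r n ≤ n) :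
    classSpan n m r l ≠ ⊥ :=
  (Submodule.ne_bot_iff _).2
    ⟨_, chainVec_mem_classSpan (self_mem_wordClass hr), chainVec_ne_zero hr hl hl'⟩

theorem classSpan_irreducible (m : ℕ) (hr : IsBallot r) (hl : ones r n ≤ l)
    (hl' : l + ones r n ≤ n) : IsIrreducibleSubmodule n m (classSpan n m r l) := by
  rw [isIrreducibleSubmodule_iff]
  refine ⟨classSpan_invariant n m r l, classSpan_ne_bot hr hl hl', fun N hle hN h0 => ?_⟩
  refine le_antisymm hle ?_
  obtain ⟨t, ht, htN⟩ := exists_chainVec_mem m.le_succ hN h0 hle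
  have h2 := ht.2.1
  have := classSpan_le_of_mem hN ht.1 (by omega) (by omega) htN
  rwa [classSpan_eq ht] at this

theorem classSpan_one (hr : IsBallot r) : classSpan n 1 r l = Submodule.span ℂ {chainVec n r l} := by
  refine le_antisymm (Submodule.span_mono ?_) ?_
  · rintro _ ⟨⟨t, ht⟩, rfl⟩
    have : t = r := by
      funext p
      -- The first letter of a ballot word is always 0.
      rcases Nat.eq_zero_or_pos (p : ℕ) with h | h
      · have h1 := (ht.1 p).2
        have h2 := (hr p).2
        have := ht.1.eq_zero_or_one p
        have := hr.eq_zero_or_one p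
        omega
      · exact ht.2.2 p h
    subst this
    rfl
  · rw [Submodule.span_singleton_le_iff_mem]
    exact chainVec_mem_classSpan (self_mem_wordClass hr)

theorem isGZSubspace_iff (hn : 1 ≤ n) (hr : IsBallot r) (hl : ones r n ≤ l)
    (hl' : l + ones r n ≤ n) (L : Submodule ℂ (V n)) :
    IsGZSubspace n (classSpan n n r l) L ↔
      ∃ t ∈ wordClass n n r, L = Submodule.span ℂ {chainVec n t l} := by
  constructor
  · rintro ⟨F, hFn, hF1, hmono, hirr⟩
    -- Descent from m = n: F_m lies in a class span for m+1, so it contains a chain vector, hence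
    -- the class span of that vector for m, and irreducibility makes the two equal.
    have key : ∀ d m, m + d = n → 1 ≤ m → ∃ t ∈ wordClass n n r, F m = classSpan n m t l := by
      intro d
      induction d with
      | zero =>
        intro m hm _
        obtain rfl : m = n := by omega
        exact ⟨r, self_mem_wordClass hr, hFn⟩
      | succ d ih =>
        intro m hm h1
        obtain ⟨t, ht, hFt⟩ := ih (m + 1) (by omega) (by omega)
        obtain ⟨hinv, hne, hsub⟩ := isIrreducibleSubmodule_iff.1 (hirr m h1 (by omega))
        obtain ⟨s, hs, hsF⟩ := exists_chainVec_mem le_rfl hinv hne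
          (hFt ▸ hmono m h1 (by omega))
        have h2 := hs.2.1
        have h3 := ht.2.1
        refine ⟨s, ⟨hs.1, h2.trans h3, fun p hp => by omega⟩, ?_⟩
        exact (hsub _ (classSpan_le_of_mem hinv hs.1 (by omega) (by omega) hsF)
          (classSpan_invariant n m s l) (classSpan_ne_bot hs.1 (by omega) (by omega))).symm
    obtain ⟨t, ht, h⟩ := key (n - 1) 1 (by omega) le_rfl
    exact ⟨t, ht, by rw [← hF1, h, classSpan_one ht.1]⟩
  · rintro ⟨t, ht, rfl⟩
    have h2 := ht.2.1
    exact ⟨fun m => classSpan n m t l, classSpan_eq ht, classSpan_one ht.1,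
      fun m _ _ => classSpan_mono (Nat.le_succ m) t l,
      fun m _ _ => classSpan_irreducible m ht.1 (by omega) (by omega)⟩

end GelfandTsetlin

/-! ### Counting letters, and a ballot word for every shape -/

section RowCount

variable {n : ℕ} {r : Fin n → ℕ}

/-- The number of `i` among the first `m` with `r i = a`. -/
def rowCount (r : Fin n → ℕ) (a m : ℕ) : ℕ :=
  (univ.filter fun i : Fin n => (i : ℕ) < m ∧ r i = a).card

theorem rowCount_one (r : Fin n → ℕ) (m : ℕ) : rowCount r 1 m = ones r m := rfl

theorem rowCount_lt {i : Fin n} {m : ℕ} (h : (i : ℕ) < m) :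
    rowCount r (r i) i < rowCount r (r i) m := by
  refine card_lt_card ((ssubset_iff_of_subset fun p hp => ?_).2 ⟨i, by simp [h], by simp⟩)
  simp only [mem_filter, mem_univ, true_and] at hp ⊢
  exact ⟨hp.1.trans h, hp.2⟩

theorem rowCount_mono (r : Fin n → ℕ) (a : ℕ) {m m' : ℕ} (h : m ≤ m') :
    rowCount r a m ≤ rowCount r a m' := by
  refine card_le_card fun p hp => ?_
  simp only [mem_filter, mem_univ, true_and] at hp ⊢
  exact ⟨hp.1.trans_le h, hp.2⟩

theorem rowCount_zero_add_ones (hr : ∀ j, r j ≤ 1) {m : ℕ} (hm : m ≤ n) :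
    rowCount r 0 m + ones r m = m := by
  have h : (univ.filter fun i : Fin n => (i : ℕ) < m).card = m := by
    rw [Fin.card_filter_val_lt, min_eq_right hm]
  conv_rhs => rw [← h]
  rw [← card_filter_add_card_filter_not (s := univ.filter fun i : Fin n => (i : ℕ) < m)
    (fun i => r i = 0), filter_filter, filter_filter]
  refine congrArg₂ _ rfl ?_
  unfold ones
  congr 1
  refine filter_congr fun i _ => and_congr_right fun _ => ?_
  have := hr i
  omega

theorem wordContent_eq (hr : ∀ j, r j ≤ 1) (j : Fin n) :
    wordContent r j = (rowCount r (r j) j : ℤ) - r j := by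
  have h := rowCount_zero_add_ones hr j.2.le
  have hj := hr j
  unfold wordContent
  split_ifs with h0
  · rw [h0]
    omega
  · have h1 : r j = 1 := by omega
    rw [h1, rowCount_one]
    simp

theorem exists_isBallot {n k : ℕ} (hk : 2 * k ≤ n) :
    ∃ r : Fin n → ℕ, IsBallot r ∧ ones r n = k := by
  let r : Fin n → ℕ := fun j => if (j : ℕ) < n - k then 0 else 1
  have h : ∀ m ≤ n, ones r m = m - (n - k) := by
    intro m
    induction m with
    | zero => simp [ones_zero]
    | succ m ih =>
      intro hm
      have h1 := ones_succ r ⟨m, hm⟩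
      simp only [r] at h1
      rw [h1, ih (by omega)]
      by_cases h2 : m < n - k
      · simp [h2]; omega
      · simp [h2]; omega
  refine ⟨r, fun j => ?_, by rw [h n le_rfl]; omega⟩
  rw [h j j.2.le]
  have := j.2
  by_cases h2 : (j : ℕ) < n - k
  · simp [r, h2]
  · simp [r, h2]; omega

end RowCount

/-! ### Standard two-row tableaux correspond to ballot words -/

section Tableaux

variable {n k : ℕ} {hk : 2 * k ≤ n}

theorem mem_twoRow_cells {b : ℕ × ℕ} :
    b ∈ (twoRow n k hk).cells ↔ (b.1 = 0 ∧ b.2 < n - k) ∨ (b.1 = 1 ∧ b.2 < k) := by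
  rw [YoungDiagram.mem_cells, twoRow, YoungDiagram.mem_ofRowLens]
  obtain ⟨a, c⟩ := b
  match a with
  | 0 => simp
  | 1 => simp
  | a + 2 => simp

theorem card_twoRow_cells : (twoRow n k hk).cells.card = n := by
  have : (twoRow n k hk).cells = {0} ×ˢ range (n - k) ∪ {1} ×ˢ range k := by
    ext ⟨a, c⟩
    rw [mem_twoRow_cells]
    simp only [mem_union, mem_product, mem_singleton, mem_range]
  rw [this, card_union_of_disjoint]
  · simp; omega
  · rw [disjoint_left]
    rintro ⟨a, c⟩ h h'
    simp at h h'
    omega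

theorem Tab.row_le_one (T : Tab n k hk) (j : Fin n) : T.row j ≤ 1 := by
  have := mem_twoRow_cells.1 (T.box j).2
  unfold StandardYoungTableau.row
  omega

theorem Tab.exists_box (T : Tab n k hk) {a c : ℕ} (h : (a, c) ∈ (twoRow n k hk).cells) :
    ∃ i, (T.box i).1 = (a, c) :=
  ⟨T.box.symm ⟨(a, c), h⟩, by simp⟩

/-- The entries to the left of j are exactly the smaller entries of its row, and they fill the
columns 0, 1, … without gaps. Hence the row word determines the tableau. -/
theorem Tab.col_eq (T : Tab n k hk) (j : Fin n) :
    (T.box j).1.2 = rowCount T.row (T.row j) j := by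
  have h : (univ.filter fun i : Fin n => (i : ℕ) < j ∧ T.row i = T.row j).image
      (fun i => (T.box i).1.2) = range (T.box j).1.2 := by
    ext c
    simp only [mem_image, mem_filter, mem_univ, true_and, mem_range]
    constructor
    · rintro ⟨i, ⟨h1, h2⟩, rfl⟩
      by_contra h
      rcases Nat.lt_or_eq_of_le (not_lt.1 h) with h | h
      · have := T.row_increasing j i h2.symm h
        rw [Fin.lt_def] at this
        omega
      · have : i = j := T.box.injective (Subtype.ext (Prod.ext h2 h.symm))
        rw [this] at h1
        omega
    · intro hc
      have hm : (T.row j, c) ∈ (twoRow n k hk).cells := by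
        have := mem_twoRow_cells.1 (T.box j).2
        rw [mem_twoRow_cells]
        simp only [StandardYoungTableau.row]
        omega
      obtain ⟨i, hi⟩ := T.exists_box hm
      have h2 : (T.box i).1.1 = T.row j := by rw [hi]
      have h3 : (T.box i).1.2 = c := by rw [hi]
      exact ⟨i, ⟨T.row_increasing i j h2 (by omega), h2⟩, h3⟩
  have h' := congrArg card h
  rw [card_range, card_image_of_injOn] at h'
  · exact h'.symm
  · intro i hi i' hi' hii
    simp only [coe_filter, mem_univ, true_and, Set.mem_ofPred_eq] at hi hi'
    exact T.box.injective (Subtype.ext (Prod.ext (hi.2.trans hi'.2.symm) hii))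

theorem Tab.isBallot (T : Tab n k hk) : IsBallot T.row := by
  refine fun j => ⟨T.row_le_one j, fun h1 => ?_⟩
  have hc := T.col_eq j
  rw [h1, rowCount_one] at hc
  have hm : (0, (T.box j).1.2) ∈ (twoRow n k hk).cells := by
    have h1 : (T.box j).1.1 = 1 := h1
    have := mem_twoRow_cells.1 (T.box j).2
    rw [mem_twoRow_cells]
    refine Or.inl ⟨rfl, ?_⟩
    change (T.box j).1.2 < n - k
    omega
  -- The entry i directly above j is smaller than j, so more first-row entries than the column index
  -- of j precede j.
  obtain ⟨i, hi⟩ := T.exists_box hm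
  have hi0 : T.row i = 0 := by unfold StandardYoungTableau.row; rw [hi]
  have hij : i < j := T.col_increasing i j (by rw [hi]) (by
    change T.row i < T.row j
    omega)
  have hci := T.col_eq i
  have hlt := rowCount_lt (r := T.row) (i := i) (m := j) hij
  have hs := rowCount_zero_add_ones T.row_le_one j.2.le
  rw [hi0] at hci hlt
  rw [hi] at hci
  simp only at hci
  omega

theorem Tab.content_eq (T : Tab n k hk) (j : Fin n) :
    content (T.box j).1 = wordContent T.row j := by
  rw [wordContent_eq T.row_le_one, ← T.col_eq]
  rfl

theorem Tab.ones_eq (T : Tab n k hk) : ones T.row n = k := by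
  rw [ones_self]
  refine Eq.trans ?_ (card_range k)
  refine card_nbij (fun i => (T.box i).1.2) ?_ ?_ ?_
  · intro i hi
    have hi : T.row i = 1 := by simpa using hi
    have hi : (T.box i).1.1 = 1 := hi
    have := mem_twoRow_cells.1 (T.box i).2
    have : (T.box i).1.2 < k := by omega
    simpa using this
  · intro i hi i' hi' hii
    simp only [coe_filter, mem_univ, true_and, Set.mem_ofPred_eq] at hi hi'
    exact T.box.injective (Subtype.ext (Prod.ext (hi.trans hi'.symm) hii))
  · intro c hc
    simp only [coe_range, Set.mem_Iio] at hc
    obtain ⟨i, hi⟩ := T.exists_box (a := 1) (c := c) (mem_twoRow_cells.2 (Or.inr ⟨rfl, hc⟩))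
    have h1 : T.row i = 1 := by unfold StandardYoungTableau.row; rw [hi]
    exact ⟨i, by simpa using h1, by simp only [hi]⟩

theorem Tab.row_injective :
    Function.Injective fun T : Tab n k hk => T.row := by
  intro T T' h
  have h : T.row = T'.row := h
  have hb : T.box = T'.box := by
    refine Equiv.ext fun j => Subtype.ext (Prod.ext (congrFun h j) ?_)
    rw [T.col_eq, T'.col_eq, h]
  cases T
  cases T'
  cases hb
  rfl

theorem exists_tab {r : Fin n → ℕ} (hr : IsBallot r) (ho : ones r n = k) :
    ∃ T : Tab n k hk, T.row = r := by
  have hle : ∀ j, r j ≤ 1 := fun j => (hr j).1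
  have hmem : ∀ j, (r j, rowCount r (r j) j) ∈ (twoRow n k hk).cells := by
    intro j
    have h1 := rowCount_lt (r := r) (i := j) j.2
    have h2 := rowCount_zero_add_ones hle le_rfl
    rw [mem_twoRow_cells]
    rcases hr.eq_zero_or_one j with h | h <;> rw [h] at h1 ⊢
    · left; exact ⟨rfl, by simp only; omega⟩
    · right; exact ⟨rfl, by rw [← ho]; exact h1⟩
  let f : Fin n → {b : ℕ × ℕ // b ∈ (twoRow n k hk).cells} := fun j => ⟨_, hmem j⟩
  have hf : Function.Injective f := by
    intro i j hij
    have h := Prod.ext_iff.1 (congrArg Subtype.val hij)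
    obtain ⟨h1, h2⟩ : r i = r j ∧ rowCount r (r i) i = rowCount r (r j) j := h
    rcases lt_trichotomy (i : ℕ) j with h | h | h
    · have := rowCount_lt (r := r) h
      rw [h2, h1] at this
      omega
    · exact Fin.ext h
    · have := rowCount_lt (r := r) h
      rw [← h2, ← h1] at this
      omega
  -- An injection between sets with n elements each.
  have hbij : Function.Bijective f := by
    rw [Fintype.bijective_iff_injective_and_card]
    refine ⟨hf, ?_⟩
    rw [Fintype.card_fin, Fintype.card_coe, card_twoRow_cells]
  refine ⟨⟨Equiv.ofBijective f hbij, ?_, ?_⟩, rfl⟩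
  · intro i j h1 h2
    change r i = r j at h1
    change rowCount r (r i) i < rowCount r (r j) j at h2
    by_contra h
    have := rowCount_mono r (r i) (show (j : ℕ) ≤ i from not_lt.1 h)
    rw [h1] at this h2
    omega
  · intro i j h1 h2
    change rowCount r (r i) i = rowCount r (r j) j at h1
    change r i < r j at h2
    have hj := hle j
    have hi : r i = 0 := by omega
    have hj : r j = 1 := by omega
    by_contra h
    have h3 := rowCount_mono r 0 (show (j : ℕ) ≤ i from not_lt.1 h)
    have h4 := rowCount_zero_add_ones hle j.2.le
    have h5 := (hr j).2 hj
    rw [hi, hj, rowCount_one] at h1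
    omega

theorem exists_jordanVec_iff {r : Fin n → ℕ} (ho : ones r n = k) (l : ℕ) (P : V n → Prop) :
    (∃ T : Tab n k hk, P (jordanVec T l)) ↔ ∃ t ∈ wordClass n n r, P (chainVec n t l) := by
  constructor
  · rintro ⟨T, hT⟩
    -- For m = n the agreement condition of `wordClass` is vacuous, so the class consists of all
    -- words of the shape.
    exact ⟨T.row, ⟨T.isBallot, T.ones_eq.trans ho.symm, fun p hp => by omega⟩, hT⟩
  · rintro ⟨t, ht, hP⟩
    obtain ⟨T, rfl⟩ := exists_tab (hk := hk) ht.1 (ht.2.1.trans ho)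
    exact ⟨T, hP⟩

end Tableaux

/-! ### The chains are symmetric Jordan chains -/

section Chains

variable {n k : ℕ} {hk : 2 * k ≤ n}

theorem mem_jordanChain {T : Tab n k hk} {v : V n} (h : v ∈ jordanChain T) :
    ∃ l, k ≤ l ∧ l + k ≤ n ∧ v = jordanVec T l := by
  simp only [jordanChain, List.mem_map, List.mem_range'_1] at h
  obtain ⟨l, ⟨h1, h2⟩, rfl⟩ := h
  exact ⟨l, h1, by omega, rfl⟩

theorem isSymmetricJordanChain_jordanChain (T : Tab n k hk) :
    IsSymmetricJordanChain n k (jordanChain T) := by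
  have hne : jordanChain T ≠ [] := by
    simp [jordanChain]
    omega
  have hlen : (jordanChain T).length = n + 1 - 2 * k := by simp [jordanChain]
  have hget : ∀ i (hi : i < (jordanChain T).length),
      (jordanChain T)[i] = jordanVec T (k + i) := by
    intro i hi
    simp [jordanChain]
  have hlast : (jordanChain T).getLast hne = jordanVec T (n - k) := by
    rw [List.getLast_eq_getElem, hget, hlen]
    congr 1
    omega
  have hup : ∀ l, k ≤ l → up n (jordanVec T l) = jordanVec T (l + 1) := fun l hl =>
    up_chainVec T.isBallot (by rw [T.ones_eq]; exact hl)
  refine ⟨hne, ?_, ?_, ?_, ?_, ?_, ?_⟩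
  · intro v hv
    obtain ⟨l, h1, h2, rfl⟩ := mem_jordanChain hv
    exact chainVec_ne_zero T.isBallot (by rw [T.ones_eq]; exact h1) (by rw [T.ones_eq]; exact h2)
  · intro v hv
    obtain ⟨l, h1, h2, rfl⟩ := mem_jordanChain hv
    exact ⟨l, chainVec_mem_level T.isBallot l⟩
  · rw [List.isChain_iff_getElem]
    intro i hi
    rw [hget, hget]
    exact hup _ (by omega)
  · rw [hlast, hup _ (by omega)]
    exact chainVec_eq_zero T.isBallot (by rw [T.ones_eq]; omega)
  · rw [List.head_eq_getElem, hget]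
    exact chainVec_mem_level T.isBallot _
  · exact ⟨n - k, by omega, hlast ▸ chainVec_mem_level T.isBallot _⟩

end Chains

/-! ### Basis, direct sum decomposition and Gelfand–Tsetlin bases -/

section Decomposition

theorem isInternal_of_linearIndependent_sigma {ι : Type*} [DecidableEq ι] {τ : ι → Type*}
    {M : Type*} [AddCommGroup M] [Module ℂ M] {b : (Σ p, τ p) → M} (hb : LinearIndependent ℂ b)
    (hs : Submodule.span ℂ (Set.range b) = ⊤) :
    DirectSum.IsInternal fun p => Submodule.span ℂ (Set.range fun t : τ p => b ⟨p, t⟩) := by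
  rw [DirectSum.isInternal_submodule_iff_iSupIndep_and_iSup_eq_top]
  constructor
  · intro p
    have h := hb.disjoint_span_image
      (s := {q | q.1 = p}) (t := {q | q.1 ≠ p}) (by
        rw [Set.disjoint_left]
        exact fun q h h' => h' h)
    refine h.mono (Submodule.span_mono ?_) (iSup₂_le fun p' hp => Submodule.span_mono ?_)
    · rintro _ ⟨t, rfl⟩
      exact ⟨⟨p, t⟩, rfl, rfl⟩
    · rintro _ ⟨t, rfl⟩
      exact ⟨⟨p', t⟩, hp, rfl⟩
  · rw [eq_top_iff, ← hs, Submodule.span_le]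
    rintro _ ⟨⟨p, t⟩, rfl⟩
    exact Submodule.mem_iSup_of_mem p (Submodule.subset_span ⟨t, rfl⟩)

variable (n : ℕ)

/-- The index of a member of a chain, with its tableau replaced by its row word. -/
def toChainIndex (q : Σ p : PairIndex n, Tab n p.1.1 p.1.2) : ChainIndex n :=
  ⟨(q.2.row, q.1.2.1), q.2.isBallot, by
    have := q.2.ones_eq
    have := q.1.2.2
    have := q.1.1.2
    simp only
    omega⟩

theorem toChainIndex_injective : Function.Injective (toChainIndex n) := by
  rintro ⟨⟨⟨k, hk⟩, ⟨i, hi⟩⟩, T⟩ ⟨⟨⟨k', hk'⟩, ⟨i', hi'⟩⟩, T'⟩ h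
  have h := Prod.ext_iff.1 (congrArg Subtype.val h)
  obtain ⟨h1, h2⟩ : T.row = T'.row ∧ i = i' := h
  have h3 : k = k' := by
    have a := T.ones_eq
    have b := T'.ones_eq
    rw [h1] at a
    exact a.symm.trans b
  subst h2 h3
  rw [Tab.row_injective h1]

theorem toChainIndex_surjective : Function.Surjective (toChainIndex n) := by
  rintro ⟨⟨r, l⟩, h1, h2, h3⟩
  simp only at h1 h2 h3
  have hk := h1.two_mul_ones_le le_rfl
  obtain ⟨T, hT⟩ := exists_tab (hk := hk) h1 rfl
  refine ⟨⟨⟨⟨ones r n, hk⟩, ⟨l, h2, by simp only; omega⟩⟩, T⟩, ?_⟩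
  exact Subtype.ext (Prod.ext hT rfl)

theorem linearIndependent_jordanVec :
    LinearIndependent ℂ fun q : Σ p : PairIndex n, Tab n p.1.1 p.1.2 => jordanVec q.2 q.1.2.1 := by
  have h : (fun q : Σ p : PairIndex n, Tab n p.1.1 p.1.2 => jordanVec q.2 q.1.2.1) =
      (fun q : ChainIndex n => chainVec n q.1.1 q.1.2) ∘ toChainIndex n := by
    funext q
    rfl
  rw [h]
  exact (linearIndependent_chainVec n).comp (toChainIndex n) (toChainIndex_injective n)

theorem span_range_jordanVec :
    Submodule.span ℂ (Set.range fun q : Σ p : PairIndex n, Tab n p.1.1 p.1.2 =>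
      jordanVec q.2 q.1.2.1) = ⊤ := by
  rw [← span_range_chainVec n]
  congr 1
  exact (toChainIndex_surjective n).range_comp fun q : ChainIndex n => chainVec n q.1.1 q.1.2

theorem isInternal_W : DirectSum.IsInternal (W n) := by
  have h := isInternal_of_linearIndependent_sigma
    (b := fun q : Σ p : PairIndex n, Tab n p.1.1 p.1.2 => jordanVec q.2 q.1.2.1)
    (linearIndependent_jordanVec n) (span_range_jordanVec n)
  have hW : W n = fun p => Submodule.span ℂ
      (Set.range fun T : Tab n p.1.1 p.1.2 => jordanVec T p.2.1) := by
    funext p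
    rfl
  rw [hW]
  exact h

variable {n}

theorem W_eq_classSpan (p : PairIndex n) {r : Fin n → ℕ} (ho : ones r n = p.1.1) :
    W n p = classSpan n n r p.2.1 := by
  unfold W classSpan
  congr 1
  ext v
  have := exists_jordanVec_iff (hk := p.1.2) ho p.2.1 (fun w => w = v)
  simpa [Set.mem_range] using this

theorem isGelfandTsetlinBasis_jordanVec (hn : 1 ≤ n) (p : PairIndex n) :
    IsGelfandTsetlinBasis n (W n p)
      (fun T : Tab n p.1.1 p.1.2 => jordanVec T p.2.1) := by
  obtain ⟨r, hr, ho⟩ := exists_isBallot p.1.2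
  have h1 := p.1.2
  have h2 := p.2.2
  refine ⟨?_, ?_, rfl, fun L => ?_⟩
  · rw [W_eq_classSpan p ho]
    exact classSpan_irreducible n hr (by omega) (by omega)
  · exact (linearIndependent_jordanVec n).comp (fun T => ⟨p, T⟩) fun T T' h => by simpa using h
  · rw [W_eq_classSpan p ho, isGZSubspace_iff hn hr (by omega) (by omega)]
    exact (exists_jordanVec_iff (hk := p.1.2) ho p.2.1 fun w => L = Submodule.span ℂ {w}).symm

end Decomposition

end Johnson

theorem mainTheorem12 (n : ℕ) (hn : 1 ≤ n) :
    -- each `B_{n,k}(T)` is a symmetric Jordan chain from rank `k` to rank `n - k`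
    (∀ (k : ℕ) (hk : 2 * k ≤ n) (T : Johnson.Tab n k hk),
      Johnson.IsSymmetricJordanChain n k (Johnson.jordanChain T)) ∧
    -- each of its vectors is an eigenvector of every `Y_j`, with eigenvalue `c(b_T(j))`
    (∀ (k : ℕ) (hk : 2 * k ≤ n) (T : Johnson.Tab n k hk), ∀ v ∈ Johnson.jordanChain T,
      ∀ j : Fin n, (Johnson.permRep n).asAlgebraHom (Johnson.yjm n j) v =
        ((Johnson.content (T.box j).1 : ℤ) : ℂ) • v) ∧
    -- the chains together form a basis of `V(B(n))`
    (∃ b : Module.Basis (Σ p : Johnson.PairIndex n, Johnson.Tab n p.1.1 p.1.2) ℂ (Johnson.V n),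
      ∀ q, b q = Johnson.jordanVec q.2 q.1.2.1) ∧
    -- it is a Gelfand–Tsetlin basis: `V(B(n))` is the direct sum of the irreducible
    -- `S_n`-submodules `W(n, k, i)`, and the basis vectors lying in `W(n, k, i)` form
    -- a Gelfand–Tsetlin basis of it
    DirectSum.IsInternal (Johnson.W n) ∧
    (∀ p : Johnson.PairIndex n, Johnson.IsGelfandTsetlinBasis n (Johnson.W n p)
      (fun T : Johnson.Tab n p.1.1 p.1.2 => Johnson.jordanVec T p.2.1)) := by
  refine ⟨fun k hk T => Johnson.isSymmetricJordanChain_jordanChain T, fun k hk T v hv j => ?_,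
    ⟨Module.Basis.mk (Johnson.linearIndependent_jordanVec n)
      (Johnson.span_range_jordanVec n).ge, fun q => Module.Basis.mk_apply _ _ q⟩,
    Johnson.isInternal_W n,
    Johnson.isGelfandTsetlinBasis_jordanVec hn⟩
  obtain ⟨l, _, _, rfl⟩ := Johnson.mem_jordanChain hv
  rw [Johnson.asAlgebraHom_yjm, T.content_eq]
  exact Johnson.yjmEnd_chainVec T.isBallot l j
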